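/- An *S-manifold* is a space obtained from a collection of Euclidean equilateral triangles of side length $1$, forming a two-dimensional simplicial complex, in which every edge is shared by exactly two triangles and every vertex is shared by exactly five, six or seven triangles, which form one cycle around the vertex. A vertex is called *elliptic*, *Euclidean* or *hyperbolic* if it is shared by five, six or seven triangles, respectively. A *line* of an S-manifold is the trace of a piecewise linear curve, parametrized by arc length on all of $\mathbb{R}$, which is straight in the Euclidean sense within each triangle and each pair of adjacent triangles laid flat in the plane, and which makes two equal angles at each vertex it passes (two angles of $150^\circ$, $180^\circ$ or $210^\circ$ at an elliptic, Euclidean or hyperbolic vertex). Two lines are *parallel* if they have no point in common. Let $l$ be a line and $P$ a point not on $l$. The point $P$ is *Euclidean* with respect to $l$ if exactly one line through $P$ is parallel to $l$; *elliptic* if no line through $P$ is parallel to $l$; *hyperbolic* if at least two lines through $P$ are parallel to $l$; and *regularly hyperbolic* if it is hyperbolic and infinitely many lines through $P$ are parallel to $l$ and infinitely many lines through $P$ are not. A geometry is *semi-paradoxist* if it has Euclidean, elliptic and regularly hyperbolic points (each with respect to some line). **Theorem.** There is an S-manifold $M$, homeomorphic to the plane, with a hyperbolic vertex $h$ and an elliptic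 vertex $e$ that are joined by an edge, all of whose other vertices are Euclidean, and in $M$ there is a line $l$ such that, with respect to this one line $l$, there are a point $P$ that is Euclidean (exactly one parallel to $l$ through $P$), a point $Q$ that is elliptic (no parallel to $l$ through $Q$), and a point $R$ that is regularly hyperbolic (infinitely many parallels and infinitely many non-parallels to $l$ through $R$). In particular, $M$ is semi-paradoxist. -/

import Mathlib

/-- `w` runs once cyclically around the vertex `v` of the family of triangles `F`: the triangles of
`F` containing `v` are exactly the triangles `v, w i, w (i + 1)`, for `i` in `ℤ/n`. -/
structure IsLinkCycle {V : Type*} [DecidableEq V] (F : Set (Finset V)) (v : V) {n : ℕ}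
    (w : ZMod n → V) : Prop where
  injective : Function.Injective w
  faces_iff : ∀ f : Finset V, (f ∈ F ∧ v ∈ f) ↔ ∃ i : ZMod n, f = {v, w i, w (i + 1)}

/-- An S-manifold, as a (simplicial) collection of triangles on the vertex set `V`: every edge lies
in exactly two triangles, and every vertex lies in exactly five, six or seven triangles, which form
one cycle around it (so that the space is a surface). Each triangle is given by its set of three
vertices, and is realized below as a Euclidean equilateral triangle of side length one. -/
structure SManifold (V : Type*) [DecidableEq V] where
  /-- the vertex sets of the triangles -/
  faces : Set (Finset V)
  card_face : ∀ f ∈ faces, f.card = 3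
  edge_shared : ∀ f ∈ faces, ∀ e ⊆ f, e.card = 2 → {g ∈ faces | e ⊆ g}.ncard = 2
  vertex_shared : ∀ v : V, {f ∈ faces | v ∈ f}.ncard ∈ ({5, 6, 7} : Set ℕ)
  link_cycle : ∀ v : V, ∃ w : ZMod {f ∈ faces | v ∈ f}.ncard → V, IsLinkCycle faces v w

namespace SManifold

variable {V : Type*} [DecidableEq V]

/-- The number of triangles around a vertex. -/
noncomputable def degree (M : SManifold V) (v : V) : ℕ := {f ∈ M.faces | v ∈ f}.ncard

def IsEllipticVertex (M : SManifold V) (v : V) : Prop := M.degree v = 5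

def IsEuclideanVertex (M : SManifold V) (v : V) : Prop := M.degree v = 6

def IsHyperbolicVertex (M : SManifold V) (v : V) : Prop := M.degree v = 7

/-- Two vertices are adjacent if they are the two ends of an edge of some triangle. -/
def Adjacent (M : SManifold V) (v w : V) : Prop := v ≠ w ∧ ∃ f ∈ M.faces, v ∈ f ∧ w ∈ f

/-- The closed triangular disk with vertex set `f`, in barycentric coordinates. -/
def disk (f : Finset V) : Set (V → ℝ) :=
  {x | (∀ v, 0 ≤ x v) ∧ (∀ v, v ∉ f → x v = 0) ∧ ∑ v ∈ f, x v = 1}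

/-- The points of an S-manifold: those of its triangular disks. The topology is the one induced
from `V → ℝ`, which is the usual topology of the realization as the triangulation is locally
finite. -/
def points (M : SManifold V) : Set (V → ℝ) := {x | ∃ f ∈ M.faces, x ∈ disk f}

/-- The third vertex of the unit equilateral triangle over the segment from `0` to `1`. -/
noncomputable def ζ : ℂ := Complex.exp ((Real.pi / 3 : ℝ) * Complex.I)

/-- Two adjacent triangles `a, b, c` and `d, b, c`, laid flat in the plane: `b` is placed at `0`,
`c` at `1`, `a` at `ζ` and `d` at the conjugate of `ζ`. -/
noncomputable def unfold (a c d : V) (x : V → ℝ) : ℂ :=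
  (x c : ℂ) + (x a : ℂ) * ζ + (x d : ℂ) * (starRingEnd ℂ) ζ

/-- Around the parameter `t`, the curve `γ` stays in two adjacent triangles and is a straight
segment of unit speed when these are laid flat. -/
def StraightAt (M : SManifold V) (γ : ℝ → V → ℝ) (t : ℝ) : Prop :=
  ∃ a b c d : V, a ≠ d ∧ {a, b, c} ∈ M.faces ∧ {d, b, c} ∈ M.faces ∧
    ∃ z u : ℂ, ‖u‖ = 1 ∧ ∃ ε > 0, ∀ s : ℝ, |s| < ε →
      γ (t + s) ∈ disk {a, b, c} ∪ disk {d, b, c} ∧ unfold a c d (γ (t + s)) = z + s * u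

/-- `x` is the point at distance `r` from the vertex `p` of the triangle `p, q, q'`, on the ray that
leaves `p` at the angle `α` from the edge `p, q`. -/
def OnRay (p q q' : V) (α r : ℝ) (x : V → ℝ) : Prop :=
  x ∈ disk {p, q, q'} ∧ (x q : ℂ) + (x q' : ℂ) * ζ = r * Complex.exp (α * Complex.I)

/-- At the parameter `t` the curve `γ` passes through a vertex `p`; near `t` it consists of two
unit speed segments ending at `p`, which make two equal angles at `p`: with `n` triangles around
`p`, whose angles add up to `n * (π / 3)`, each of the two angles is `n * (π / 6)`. -/
def BisectsAt (M : SManifold V) (γ : ℝ → V → ℝ) (t : ℝ) : Prop :=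
  ∃ (p : V) (w : ZMod (M.degree p) → V), IsLinkCycle M.faces p w ∧
    ∃ α ∈ Set.Icc 0 (Real.pi / 3), ∃ β ∈ Set.Icc 0 (Real.pi / 3), ∃ k : ℕ, k < M.degree p ∧
      k * (Real.pi / 3) + β - α = M.degree p * (Real.pi / 6) ∧
      ∃ ε > 0, ∀ s : ℝ, 0 ≤ s → s < ε →
        OnRay p (w 0) (w 1) α s (γ (t + s)) ∧
        OnRay p (w (k : ZMod (M.degree p))) (w ((k : ZMod (M.degree p)) + 1)) β s (γ (t - s))

/-- The lines (complete geodesics) of an S-manifold, as sets of points: traces of curves, defined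
on all of `ℝ` and of unit speed, which are straight in adjacent triangles and make two equal angles
at each vertex they pass. -/
def IsLine (M : SManifold V) (l : Set (V → ℝ)) : Prop :=
  ∃ γ : ℝ → V → ℝ, (∀ t, M.StraightAt γ t ∨ M.BisectsAt γ t) ∧ l = Set.range γ

/-- The lines through `P` parallel to `l`, that is, without a common point with `l`. -/
def parallels (M : SManifold V) (l : Set (V → ℝ)) (P : V → ℝ) : Set (Set (V → ℝ)) :=
  {m | M.IsLine m ∧ P ∈ m ∧ Disjoint m l}

/-- The lines through `P` that are not parallel to `l`. -/
def nonParallels (M : SManifold V) (l : Set (V → ℝ)) (P : V → ℝ) : Set (Set (V → ℝ)) :=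
  {m | M.IsLine m ∧ P ∈ m ∧ ¬ Disjoint m l}

/-- `P` is a point of the S-manifold outside the line `l`. -/
def PointOff (M : SManifold V) (l : Set (V → ℝ)) (P : V → ℝ) : Prop :=
  M.IsLine l ∧ P ∈ M.points ∧ P ∉ l

/-- `P` is Euclidean with respect to `l`: exactly one parallel. -/
def IsEuclideanPoint (M : SManifold V) (l : Set (V → ℝ)) (P : V → ℝ) : Prop :=
  M.PointOff l P ∧ ∃! m, m ∈ M.parallels l P

/-- `P` is elliptic with respect to `l`: no parallels. -/
def IsEllipticPoint (M : SManifold V) (l : Set (V → ℝ)) (P : V → ℝ) : Prop :=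
  M.PointOff l P ∧ M.parallels l P = ∅

/-- `P` is hyperbolic with respect to `l`: at least two parallels. -/
def IsHyperbolicPoint (M : SManifold V) (l : Set (V → ℝ)) (P : V → ℝ) : Prop :=
  M.PointOff l P ∧ (M.parallels l P).Nontrivial

/-- `P` is regularly hyperbolic with respect to `l`: hyperbolic, with infinitely many parallels and
infinitely many non-parallels. -/
def IsRegularlyHyperbolicPoint (M : SManifold V) (l : Set (V → ℝ)) (P : V → ℝ) : Prop :=
  M.IsHyperbolicPoint l P ∧ (M.parallels l P).Infinite ∧ (M.nonParallels l P).Infinite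

/-- A geometry is semi-paradoxist if it has Euclidean, elliptic and regularly hyperbolic points
(each with respect to some line). -/
def IsSemiParadoxist (M : SManifold V) : Prop :=
  (∃ l P, M.IsEuclideanPoint l P) ∧ (∃ l P, M.IsEllipticPoint l P) ∧
    ∃ l P, M.IsRegularlyHyperbolicPoint l P

/-- The triangulation type of the semi-paradoxist model: the space is homeomorphic to the plane, `h`
is a hyperbolic vertex, `e` is an elliptic vertex adjacent to it, and all other vertices are
Euclidean. -/
structure IsModel (M : SManifold V) (h e : V) : Prop where
  plane : Nonempty (M.points ≃ₜ EuclideanSpace ℝ (Fin 2))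
  hyperbolic : M.IsHyperbolicVertex h
  elliptic : M.IsEllipticVertex e
  adjacent : M.Adjacent h e
  euclidean : ∀ v : V, v ≠ h → v ≠ e → M.IsEuclideanVertex v

end SManifold

/-!
Cut the plane into unit squares and every square into two triangles by its falling diagonal, except
in the left half of one row, where the diagonals rise. All triangles being equilateral, the two
vertices at the end of that half row, `(0, 0)` and `(0, 1)`, have degrees five and seven. Outside
the half row the surface is a flat piece of the plane, where a geodesic is a straight line.

The lines of slope `-3` on which `3 * x + y` is greater than one stay in the flat part, and `l` is
one of them. A line through a point `P` on a higher one that is not itself of slope `-3` descends on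
one of the two sides of `P`, and meets `l` before it can leave the flat part. At the elliptic vertex
`Q` the two rays of a line enclose `150°`, so that one of them runs up to `l`. The point `R` is the
midpoint of the edge between the two vertices. The surface has a reflection in this edge, which
carries a line through `R` that leaves to the right with slope `-r` on to the left, where it never
comes up to `l`; hence it meets `l` if and only if `r < 3`. The slopes are taken irrational, so that
these lines avoid the vertices.
-/

open Filter Topology

namespace SManifold

section Lattice

theorem ζ_eq : ζ = ⟨1 / 2, √3 / 2⟩ := by
  unfold ζ
  rw [Complex.exp_ofReal_mul_I]
  apply Complex.ext <;> simp

theorem conj_ζ : (starRingEnd ℂ) ζ = 1 - ζ := by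
  apply Complex.ext <;> norm_num [ζ_eq]

theorem ζ_mul_ζ : ζ * ζ = ζ - 1 := by
  have h3 : √3 * √3 = (3 : ℝ) := Real.mul_self_sqrt (by norm_num)
  apply Complex.ext <;> simp [ζ_eq] <;> linarith

theorem norm_add_mul_ζ (α β : ℝ) : ‖(α + β * ζ : ℂ)‖ = √(α ^ 2 + α * β + β ^ 2) := by
  have h3 : √3 * √3 = (3 : ℝ) := Real.mul_self_sqrt (by norm_num)
  rw [Complex.norm_eq_sqrt_sq_add_sq]
  congr 1
  have hre : (α + β * ζ : ℂ).re = α + β / 2 := by simp [ζ_eq, div_eq_mul_inv]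
  have him : (α + β * ζ : ℂ).im = β * (√3 / 2) := by simp [ζ_eq]
  rw [hre, him]
  linear_combination β ^ 2 / 4 * h3

theorem add_mul_ζ_inj {a b c d : ℝ} : (a + b * ζ : ℂ) = c + d * ζ ↔ a = c ∧ b = d := by
  refine ⟨fun h => ?_, by rintro ⟨rfl, rfl⟩; rfl⟩
  have him := congrArg Complex.im h
  have hre := congrArg Complex.re h
  obtain rfl : b = d := by simpa [ζ_eq] using him
  exact ⟨by simpa [ζ_eq] using hre, rfl⟩

theorem exists_eq_add_mul_ζ (z : ℂ) : ∃ α β : ℝ, z = α + β * ζ := by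
  refine ⟨z.re - z.im / √3, 2 * z.im / √3, Complex.ext ?_ ?_⟩
  · simp [ζ_eq]; ring
  · simp [ζ_eq]; field_simp

theorem unfold_eq {V : Type*} (a c d : V) (x : V → ℝ) :
    unfold a c d x = (x c + x d : ℝ) + (x a - x d : ℝ) * ζ := by
  rw [unfold, conj_ζ]
  push_cast
  ring

end Lattice

section WeightedSum

variable {V E : Type*} [AddCommGroup E] [Module ℝ E]

/-- The point with barycentric coordinates `x`, when the vertices are placed at the points `g v`. -/
noncomputable def wsum (g : V → E) (x : V → ℝ) : E := ∑ᶠ v, x v • g v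

theorem wsum_of_mem_disk (g : V → E) {f : Finset V} {x : V → ℝ} (hx : x ∈ disk f) :
    wsum g x = ∑ v ∈ f, x v • g v :=
  finsum_eq_sum_of_support_subset _ fun v hv => by
    by_contra h
    exact hv (by simp [hx.2.1 v (by simpa using h)])

end WeightedSum

variable {V : Type*} [DecidableEq V]

theorem ne_of_card_triple {p q r : V} (h : ({p, q, r} : Finset V).card = 3) :
    p ≠ q ∧ p ≠ r ∧ q ≠ r := by
  grind

theorem sum_triple {A : Type*} [AddCommMonoid A] {p q r : V}
    (hf : ({p, q, r} : Finset V).card = 3) (φ : V → A) :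
    ∑ v ∈ {p, q, r}, φ v = φ p + φ q + φ r := by
  obtain ⟨hpq, hpr, hqr⟩ := ne_of_card_triple hf
  rw [Finset.sum_insert (by simp [hpq, hpr]), Finset.sum_pair hqr, add_assoc]

section Disk

variable {E : Type*} [AddCommGroup E] [Module ℝ E]

theorem wsum_single (g : V → E) (v : V) : wsum g (Pi.single v 1) = g v := by
  rw [wsum, finsum_eq_single _ v fun w hw => by simp [hw]]
  simp

theorem mem_disk_triple {p q r : V} (hf : ({p, q, r} : Finset V).card = 3) {x : V → ℝ} :
    x ∈ disk {p, q, r} ↔ 0 ≤ x p ∧ 0 ≤ x q ∧ 0 ≤ x r ∧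
      (∀ v, v ≠ p → v ≠ q → v ≠ r → x v = 0) ∧ x p + x q + x r = 1 := by
  simp only [disk, Set.mem_ofPred_eq, sum_triple hf, Finset.mem_insert, Finset.mem_singleton,
    not_or, and_imp]
  refine ⟨fun ⟨h₁, h₂, h₃⟩ => ⟨h₁ p, h₁ q, h₁ r, h₂, h₃⟩,
    fun ⟨hp, hq, hr, h₂, h₃⟩ => ⟨fun v => ?_, h₂, h₃⟩⟩
  by_cases hv : v = p ∨ v = q ∨ v = r
  · rcases hv with rfl | rfl | rfl <;> assumption
  · push Not at hv
    exact (h₂ v hv.1 hv.2.1 hv.2.2).ge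

theorem wsum_triple (g : V → E) {p q r : V} (hf : ({p, q, r} : Finset V).card = 3) {x : V → ℝ}
    (hx : x ∈ disk {p, q, r}) : wsum g x = x p • g p + x q • g q + x r • g r := by
  rw [wsum_of_mem_disk g hx, sum_triple hf]

theorem exists_mem_disk_wsum_eq (g : V → E) {a b c : V} (hf : ({a, b, c} : Finset V).card = 3)
    {α β δ : ℝ} (hα : 0 ≤ α) (hβ : 0 ≤ β) (hδ : 0 ≤ δ) (h : α + β + δ = 1) :
    ∃ x ∈ disk {a, b, c}, wsum g x = α • g a + β • g b + δ • g c := by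
  obtain ⟨hab, hac, hbc⟩ := ne_of_card_triple hf
  have hx : Pi.single a α + Pi.single b β + Pi.single c δ ∈ disk {a, b, c} := by
    rw [mem_disk_triple hf]
    refine ⟨?_, ?_, ?_, fun v ha hb hc => ?_, ?_⟩ <;>
      simp_all [Ne.symm]
  refine ⟨_, hx, ?_⟩
  rw [wsum_triple g hf hx]
  simp [hab, hab.symm, hac, hac.symm, hbc, hbc.symm]

theorem single_mem_disk {f : Finset V} {v : V} (hv : v ∈ f) : Pi.single v 1 ∈ disk f := by
  refine ⟨fun w => ?_, fun w hw => ?_, by simp [hv]⟩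
  · rw [Pi.single_apply]
    split_ifs <;> norm_num
  · exact Pi.single_eq_of_ne (ne_of_mem_of_not_mem hv hw).symm _

theorem eq_single_of_mem_disk {f : Finset V} {x : V → ℝ} (hx : x ∈ disk f) {v : V}
    (hv : x v = 1) : x = Pi.single v 1 := by
  have hvf : v ∈ f := by_contra fun h => by simp [hx.2.1 v h] at hv
  have hsum := hx.2.2
  rw [← Finset.add_sum_erase _ _ hvf, hv, add_eq_left,
    Finset.sum_eq_zero_iff_of_nonneg fun w _ => hx.1 w] at hsum
  ext w
  by_cases hw : w = v
  · subst hw; simpa using hv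
  · by_cases hwf : w ∈ f
    · simp [hw, hsum w (Finset.mem_erase.2 ⟨hw, hwf⟩)]
    · simp [hw, hx.2.1 w hwf]

end Disk

section Rhombus

variable {M : SManifold V} {γ : ℝ → V → ℝ} {t : ℝ} {a b c d : V}

theorem rhombus_coords (had : a ≠ d) (ha : {a, b, c} ∈ M.faces) (hd : {d, b, c} ∈ M.faces)
    {x : V → ℝ} (hx : x ∈ disk {a, b, c} ∪ disk {d, b, c}) :
    0 ≤ x b ∧ 0 ≤ x c ∧ x a = max 0 (x a - x d) ∧ x d = max 0 (x d - x a) ∧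
      x a + x b + x c + x d = 1 := by
  have hca := M.card_face _ ha
  have hcd := M.card_face _ hd
  obtain ⟨hab, hac, -⟩ := ne_of_card_triple hca
  obtain ⟨hdb, hdc, -⟩ := ne_of_card_triple hcd
  rcases hx with hx | hx
  · obtain ⟨h1, h2, h3, h4, h5⟩ := (mem_disk_triple hca).1 hx
    have := h4 d had.symm hdb hdc
    grind
  · obtain ⟨h1, h2, h3, h4, h5⟩ := (mem_disk_triple hcd).1 hx
    have := h4 a had hab hac
    grind

theorem eq_zero_of_pos (had : a ≠ d) (ha : {a, b, c} ∈ M.faces) (hd : {d, b, c} ∈ M.faces)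
    {x : V → ℝ} (hx : x ∈ disk {a, b, c} ∪ disk {d, b, c}) (hxa : 0 < x a) : x d = 0 := by
  obtain ⟨-, -, ha', -, -⟩ := rhombus_coords had ha hd hx
  grind

theorem mem_disk_of_eq_zero (ha : {a, b, c} ∈ M.faces) (hd : {d, b, c} ∈ M.faces)
    {x : V → ℝ} (hx : x ∈ disk {a, b, c}) (hxa : x a = 0) : x ∈ disk {d, b, c} := by
  obtain ⟨hab, hac, -⟩ := ne_of_card_triple (M.card_face _ ha)
  obtain ⟨hdb, hdc, -⟩ := ne_of_card_triple (M.card_face _ hd)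
  obtain ⟨-, hb, hc, h0, hsum⟩ := (mem_disk_triple (M.card_face _ ha)).1 hx
  have hxd : x d = 0 := by
    rcases eq_or_ne d a with rfl | hda
    exacts [hxa, h0 d hda hdb hdc]
  refine (mem_disk_triple (M.card_face _ hd)).2
    ⟨hxd.ge, hb, hc, fun v _ hvb hvc => ?_, by linarith⟩
  rcases eq_or_ne v a with rfl | hva
  exacts [hxa, h0 v hva hvb hvc]

theorem straightAt_iff : M.StraightAt γ t ↔ ∃ a b c d : V, a ≠ d ∧ {a, b, c} ∈ M.faces ∧
    {d, b, c} ∈ M.faces ∧ ∃ z w α β : ℝ, α ^ 2 + α * β + β ^ 2 = 1 ∧ ∀ᶠ s in 𝓝 (0 : ℝ),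
      γ (t + s) ∈ disk {a, b, c} ∪ disk {d, b, c} ∧
      γ (t + s) c + γ (t + s) d = z + s * α ∧ γ (t + s) a - γ (t + s) d = w + s * β := by
  have hiff (a b c d : V) (z w α β : ℝ) : (‖(α + β * ζ : ℂ)‖ = 1 ∧ ∃ ε > 0, ∀ s : ℝ, |s| < ε →
        γ (t + s) ∈ disk {a, b, c} ∪ disk {d, b, c} ∧
        unfold a c d (γ (t + s)) = (z + w * ζ) + s * (α + β * ζ)) ↔
      (α ^ 2 + α * β + β ^ 2 = 1 ∧ ∀ᶠ s in 𝓝 (0 : ℝ),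
        γ (t + s) ∈ disk {a, b, c} ∪ disk {d, b, c} ∧
        γ (t + s) c + γ (t + s) d = z + s * α ∧ γ (t + s) a - γ (t + s) d = w + s * β) := by
    have hz (s : ℝ) : ((z + w * ζ) + s * (α + β * ζ) : ℂ) =
        (z + s * α : ℝ) + (w + s * β : ℝ) * ζ := by push_cast; ring
    simp only [norm_add_mul_ζ, Real.sqrt_eq_one, unfold_eq, hz, add_mul_ζ_inj,
      Metric.eventually_nhds_iff, Real.dist_eq, sub_zero]
  constructor
  · rintro ⟨a, b, c, d, had, ha, hd, z, u, hu, h⟩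
    obtain ⟨z, w, rfl⟩ := exists_eq_add_mul_ζ z
    obtain ⟨α, β, rfl⟩ := exists_eq_add_mul_ζ u
    exact ⟨a, b, c, d, had, ha, hd, z, w, α, β, (hiff ..).1 ⟨hu, h⟩⟩
  · rintro ⟨a, b, c, d, had, ha, hd, z, w, α, β, h⟩
    obtain ⟨hu, h⟩ := (hiff ..).2 h
    exact ⟨a, b, c, d, had, ha, hd, z + w * ζ, α + β * ζ, hu, h⟩

theorem StraightAt.mem_points (h : M.StraightAt γ t) : γ t ∈ M.points := by
  obtain ⟨a, b, c, d, -, ha, hd, z, u, -, ε, hε, h⟩ := h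
  have h0 := (h 0 (by simpa using hε)).1
  rw [add_zero] at h0
  exact h0.elim (fun h => ⟨_, ha, h⟩) fun h => ⟨_, hd, h⟩

/-- A corner of a rhombus is an extreme point of it. -/
theorem StraightAt.ne_single (h : M.StraightAt γ t) (v : V) : γ t ≠ Pi.single v 1 := by
  obtain ⟨a, b, c, d, had, ha, hd, z, w, α, β, hαβ, h⟩ := straightAt_iff.1 h
  intro hv
  have h' := h.and (((continuous_neg (G := ℝ)).tendsto' 0 0 neg_zero).eventually h)
  obtain ⟨s, ⟨⟨hp, hp₁, hp₂⟩, hn, hn₁, hn₂⟩, hs⟩ :=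
    ((h'.filter_mono (nhdsWithin_le_nhds (s := {0}ᶜ))).and self_mem_nhdsWithin).exists
  obtain ⟨h0, h0₁, h0₂⟩ := h.self_of_nhds
  obtain ⟨hb, hc, ha', hd', h1⟩ := rhombus_coords had ha hd hp
  obtain ⟨kb, kc, ka', kd', k1⟩ := rhombus_coords had ha hd hn
  obtain ⟨lb, lc, la', ld', l1⟩ := rhombus_coords had ha hd h0
  rw [add_zero] at h0₁ h0₂ lb lc la' ld' l1 h0
  have h01 (u : V) : γ t u = 0 ∨ γ t u = 1 := by
    rw [hv, Pi.single_apply]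
    split <;> simp
  have hcorner : γ t a = 1 ∨ γ t b = 1 ∨ γ t c = 1 ∨ γ t d = 1 := by
    have := h01 a; have := h01 b; have := h01 c; have := h01 d
    grind only
  have hα : s * α = 0 := by grind
  have hβ : s * β = 0 := by grind
  grind

end Rhombus

end SManifold

namespace SManifold

variable {V : Type*} [DecidableEq V] {M : SManifold V} {γ : ℝ → V → ℝ} {t : ℝ}

section Rhombus

variable {a b c d : V} {E : Type*} [AddCommGroup E] [Module ℝ E]

theorem wsum_rhombus (g : V → E) (had : a ≠ d) (ha : {a, b, c} ∈ M.faces)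
    (hd : {d, b, c} ∈ M.faces) {x : V → ℝ} (hx : x ∈ disk {a, b, c} ∪ disk {d, b, c}) :
    wsum g x = x a • g a + x b • g b + x c • g c + x d • g d := by
  have hca := M.card_face _ ha
  have hcd := M.card_face _ hd
  obtain ⟨hab, hac, -⟩ := ne_of_card_triple hca
  obtain ⟨hdb, hdc, -⟩ := ne_of_card_triple hcd
  rcases hx with hx | hx
  · simp [wsum_triple g hca hx, hx.2.1 d (by simp [had.symm, hdb, hdc])]
  · rw [wsum_triple g hcd hx, hx.2.1 a (by simp [had, hab, hac])]
    module

end Rhombus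

section Bisects

variable {E : Type*} [AddCommGroup E] [Module ℝ E] {p q q' : V}

theorem OnRay.coords {α A B r : ℝ} {x : V → ℝ} (hx : OnRay p q q' α r x)
    (hα : Complex.exp (α * Complex.I) = A + B * ζ) : x q = r * A ∧ x q' = r * B := by
  rw [← add_mul_ζ_inj, hx.2, hα]
  push_cast
  ring

theorem OnRay.wsum_eq (g : V → E) (hf : ({p, q, q'} : Finset V).card = 3) {α A B r : ℝ}
    {x : V → ℝ} (hx : OnRay p q q' α r x) (hα : Complex.exp (α * Complex.I) = A + B * ζ) :
    wsum g x = g p + r • (A • (g q - g p) + B • (g q' - g p)) := by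
  obtain ⟨hq, hq'⟩ := hx.coords hα
  have hsum := ((mem_disk_triple hf).1 hx.1).2.2.2.2
  rw [wsum_triple g hf hx.1, hq, hq', show x p = 1 - r * A - r * B by linarith]
  module

theorem OnRay.nonneg_of_pos {α A B r : ℝ} {x : V → ℝ} (hx : OnRay p q q' α r x)
    (hα : Complex.exp (α * Complex.I) = A + B * ζ) (hr : 0 < r) : 0 ≤ A ∧ 0 ≤ B := by
  obtain ⟨hq, hq'⟩ := hx.coords hα
  exact ⟨nonneg_of_mul_nonneg_right (hq ▸ hx.1.1 q) hr,
    nonneg_of_mul_nonneg_right (hq' ▸ hx.1.1 q') hr⟩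

theorem OnRay.eq_single {α : ℝ} {x : V → ℝ} (hf : ({p, q, q'} : Finset V).card = 3)
    (hx : OnRay p q q' α 0 x) : x = Pi.single p 1 := by
  obtain ⟨A, B, hα⟩ := exists_eq_add_mul_ζ (Complex.exp (α * Complex.I))
  obtain ⟨hq, hq'⟩ := hx.coords hα
  refine eq_single_of_mem_disk hx.1 ?_
  linarith [((mem_disk_triple hf).1 hx.1).2.2.2.2]

theorem _root_.IsLinkCycle.mem {F : Set (Finset V)} {n : ℕ} {w : ZMod n → V}
    (h : IsLinkCycle F p w) (i : ZMod n) : {p, w i, w (i + 1)} ∈ F :=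
  ((h.faces_iff _).2 ⟨i, rfl⟩).1

theorem BisectsAt.exists_rays (h : M.BisectsAt γ t) (g : V → E) :
    ∃ (p : V) (w : ZMod (M.degree p) → V), IsLinkCycle M.faces p w ∧ γ t = Pi.single p 1 ∧
      ∃ k : ℕ, M.degree p ≤ 2 * k + 2 ∧ 2 * k ≤ M.degree p + 2 ∧
      ∃ A B A' B' : ℝ, 0 ≤ A ∧ 0 ≤ B ∧ 0 ≤ A' ∧ 0 ≤ B' ∧ A ^ 2 + A * B + B ^ 2 = 1 ∧
      (A' + B' * ζ : ℂ) =
        (A + B * ζ) * Complex.exp (((M.degree p - 2 * k : ℝ) * (Real.pi / 6) : ℝ) * Complex.I) ∧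
      ∃ ε > 0, ∀ s : ℝ, 0 ≤ s → s < ε →
        wsum g (γ (t + s)) = g p + s • (A • (g (w 0) - g p) + B • (g (w 1) - g p)) ∧
        wsum g (γ (t - s)) = g p + s • (A' • (g (w k) - g p) + B' • (g (w (k + 1)) - g p)) := by
  obtain ⟨p, w, hw, α, ⟨hα, hα'⟩, β, ⟨hβ, hβ'⟩, k, -, hk, ε, hε, h⟩ := h
  have hcard (i) : ({p, w i, w (i + 1)} : Finset V).card = 3 := M.card_face _ (hw.mem i)
  have hcard0 : ({p, w 0, w 1} : Finset V).card = 3 := by simpa using hcard 0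
  obtain ⟨A, B, hAB⟩ := exists_eq_add_mul_ζ (Complex.exp (α * Complex.I))
  obtain ⟨A', B', hAB'⟩ := exists_eq_add_mul_ζ (Complex.exp (β * Complex.I))
  obtain ⟨hA, hB⟩ := (h (ε / 2) (by linarith) (by linarith)).1.nonneg_of_pos hAB (half_pos hε)
  obtain ⟨hA', hB'⟩ := (h (ε / 2) (by linarith) (by linarith)).2.nonneg_of_pos hAB' (half_pos hε)
  have hpi := Real.pi_pos
  have hlow : (M.degree p : ℝ) ≤ 2 * k + 2 := by nlinarith
  have hupp : 2 * (k : ℝ) ≤ M.degree p + 2 := by nlinarith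
  have hnorm : A ^ 2 + A * B + B ^ 2 = 1 := by
    rw [← Real.sqrt_eq_one, ← norm_add_mul_ζ, ← hAB, Complex.norm_exp_ofReal_mul_I]
  have hβα : β = α + (M.degree p - 2 * k) * (Real.pi / 6) := by linarith
  refine ⟨p, w, hw, ?_, k, mod_cast hlow, mod_cast hupp, A, B, A', B', hA, hB, hA', hB', hnorm,
    ?_, ε, hε, fun s hs hsε => ⟨?_, ?_⟩⟩
  · simpa using (h 0 le_rfl hε).1.eq_single hcard0
  · rw [← hAB, ← hAB', ← Complex.exp_add, hβα]
    push_cast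
    ring_nf
  · exact (h s hs hsε).1.wsum_eq g hcard0 hAB
  · exact (h s hs hsε).2.wsum_eq g (hcard k) hAB'

end Bisects

section Continuity

theorem continuousAt_comp_add_left_iff {E : Type*} [TopologicalSpace E] (f : ℝ → E) (t : ℝ) :
    ContinuousAt (fun s => f (t + s)) 0 ↔ ContinuousAt f t := by
  rw [ContinuousAt, ContinuousAt, ← map_add_left_nhds_zero t, tendsto_map'_iff, add_zero,
    Function.comp_def]

variable {E : Type*} [AddCommGroup E] [Module ℝ E] [TopologicalSpace E] [ContinuousAdd E]
  [ContinuousSMul ℝ E]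

theorem StraightAt.continuousAt_wsum (h : M.StraightAt γ t) (g : V → E) :
    ContinuousAt (fun t => wsum g (γ t)) t := by
  obtain ⟨a, b, c, d, had, ha, hd, z, w, α, β, -, h⟩ := straightAt_iff.1 h
  let ψ (s : ℝ) : E := max 0 (w + s * β) • g a +
    (1 - max 0 (w + s * β) - (z + s * α)) • g b +
    (z + s * α - max 0 (-(w + s * β))) • g c + max 0 (-(w + s * β)) • g d
  have hψ : Continuous ψ := by fun_prop
  have heq : ψ =ᶠ[𝓝 0] fun s => wsum g (γ (t + s)) := by
    filter_upwards [h] with s ⟨hs, hcd, had'⟩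
    obtain ⟨-, -, hxa, hxd, hsum⟩ := rhombus_coords had ha hd hs
    rw [had'] at hxa
    rw [← neg_sub, had'] at hxd
    rw [wsum_rhombus g had ha hd hs,
      show γ (t + s) b = 1 - max 0 (w + s * β) - (z + s * α) by linarith,
      show γ (t + s) c = z + s * α - max 0 (-(w + s * β)) by linarith, hxa, hxd]
  exact (continuousAt_comp_add_left_iff _ _).1 (hψ.continuousAt.congr heq)

theorem BisectsAt.continuousAt_wsum (h : M.BisectsAt γ t) (g : V → E) :
    ContinuousAt (fun t => wsum g (γ t)) t := by
  obtain ⟨p, w, -, -, k, -, -, A, B, A', B', -, -, -, -, -, -, ε, hε, h⟩ := h.exists_rays g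
  let ψ (s : ℝ) : E := g p + max 0 s • (A • (g (w 0) - g p) + B • (g (w 1) - g p)) +
    max 0 (-s) • (A' • (g (w k) - g p) + B' • (g (w (k + 1)) - g p))
  have hψ : Continuous ψ := by fun_prop
  have heq : ψ =ᶠ[𝓝 0] fun s => wsum g (γ (t + s)) := by
    filter_upwards [Ioo_mem_nhds (neg_lt_zero.2 hε) hε] with s hs
    rcases le_total 0 s with h0 | h0
    · rw [(h s h0 hs.2).1]
      simp [ψ, h0]
    · rw [← sub_neg_eq_add, (h (-s) (by linarith) (by linarith [hs.1])).2]
      simp [ψ, h0]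
  exact (continuousAt_comp_add_left_iff _ _).1 (hψ.continuousAt.congr heq)

/-- A geodesic, in the sense of the statement: a curve whose trace is a line. -/
def IsGeodesic (M : SManifold V) (γ : ℝ → V → ℝ) : Prop :=
  ∀ t, M.StraightAt γ t ∨ M.BisectsAt γ t

theorem IsGeodesic.continuous_wsum (h : M.IsGeodesic γ) (g : V → E) :
    Continuous fun t => wsum g (γ t) :=
  continuous_iff_continuousAt.2 fun t =>
    (h t).elim (fun h => h.continuousAt_wsum g) fun h => h.continuousAt_wsum g

end Continuity

end SManifold

/-- Near `t`, the curve `f` runs along a line at constant nonzero speed. -/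
def LocallyStraightAt {E : Type*} [AddCommGroup E] [Module ℝ E] (f : ℝ → E) (t : ℝ) : Prop :=
  ∃ u : E, u ≠ 0 ∧ ∀ᶠ s in 𝓝 (0 : ℝ), f (t + s) = f t + s • u

section Ray

variable {E : Type*} [AddCommGroup E] [Module ℝ E] {f : ℝ → E} {t : ℝ} {p u : E}

theorem LocallyStraightAt.eventually_of_frequently (h : LocallyStraightAt f t)
    (hl : ∃ᶠ s in 𝓝[<] (0 : ℝ), f (t + s) = f t + s • u) :
    ∀ᶠ s in 𝓝 (0 : ℝ), f (t + s) = f t + s • u := by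
  obtain ⟨u', -, hu'⟩ := h
  obtain ⟨s, hs, hs', hs0⟩ := (hl.and_eventually
    ((hu'.filter_mono nhdsWithin_le_nhds).and self_mem_nhdsWithin)).exists
  rw [hs, add_right_inj] at hs'
  rwa [smul_right_injective E (ne_of_lt hs0) hs']

theorem LocallyStraightAt.comp_neg (h : LocallyStraightAt f (-t)) :
    LocallyStraightAt (fun t => f (-t)) t := by
  obtain ⟨u, hu, h⟩ := h
  refine ⟨-u, neg_ne_zero.2 hu, ?_⟩
  filter_upwards [(continuous_neg.tendsto' (0 : ℝ) 0 neg_zero).eventually h] with s hs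
  rw [neg_add, hs, neg_smul, smul_neg]

/-- Continuous induction along the ray: the set of times up to which `f` follows it is closed, and
it is open because a straight piece is determined by its past. -/
theorem eq_ray_of_locallyStraightAt [TopologicalSpace E] [T2Space E] [ContinuousAdd E]
    [ContinuousSMul ℝ E] (hf : Continuous f) {S : ℝ}
    (hloc : ∀ s ∈ Set.Ioo 0 S, f (t + s) = p + s • u → LocallyStraightAt f (t + s))
    (h0 : ∀ᶠ s in 𝓝[≥] (0 : ℝ), f (t + s) = p + s • u) {s : ℝ} (hs : s ∈ Set.Icc 0 S) :
    f (t + s) = p + s • u := by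
  refine IsClosed.Icc_subset_of_forall_mem_nhdsGT_of_Icc_subset (a := 0) (b := S)
    (s := {s | f (t + s) = p + s • u}) ?_ (h0.self_of_nhdsWithin Set.self_mem_Ici) ?_ hs
  · exact (isClosed_eq (by fun_prop) (by fun_prop)).inter isClosed_Icc
  · intro x hx hpast
    rcases hx.1.eq_or_lt with rfl | hx0
    · exact h0.filter_mono (nhdsWithin_mono _ Set.Ioi_subset_Ici_self)
    have hx' : f (t + x) = p + x • u := hpast ⟨hx.1, le_rfl⟩
    have hleft : ∀ᶠ s in 𝓝[<] (0 : ℝ), f (t + x + s) = f (t + x) + s • u := by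
      filter_upwards [Ioo_mem_nhdsLT (neg_lt_zero.2 hx0)] with s hs
      rw [add_assoc, hpast (a := x + s) ⟨by linarith [hs.1], by linarith [hs.2]⟩, hx']
      module
    have hnear := (hloc x ⟨hx0, hx.2⟩ hx').eventually_of_frequently hleft.frequently
    have hsub : Tendsto (fun y => y - x) (𝓝 x) (𝓝 0) :=
      (continuous_sub_right x).tendsto' x 0 (sub_self x)
    filter_upwards [(hsub.eventually hnear).filter_mono nhdsWithin_le_nhds] with y hy
    rw [add_assoc, add_sub_cancel, hx'] at hy
    rw [hy]
    module

end Ray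

namespace SManifold

variable {V : Type*} [DecidableEq V] {M : SManifold V} {γ : ℝ → V → ℝ} {t : ℝ}
  {E : Type*} [AddCommGroup E] [Module ℝ E] {G : Set (Finset V)} {pos : V → E}

/-- The positions `pos` lay the triangles of the family `G` flat in `E`, up to an affine map: these
are nondegenerate, and adjacent triangles form a parallelogram. -/
structure IsChart (G : Set (Finset V)) (pos : V → E) : Prop where
  linearIndependent : ∀ ⦃a b c⦄, {a, b, c} ∈ G →
    LinearIndependent ℝ ![pos c - pos b, pos a - pos b]
  rhombus : ∀ ⦃a b c d⦄, a ≠ d → {a, b, c} ∈ G → {d, b, c} ∈ G →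
    pos a + pos d = pos b + pos c

theorem IsChart.add_ne_zero (hG : IsChart G pos) {a b c : V} (ha : {a, b, c} ∈ G) {α β : ℝ}
    (h : α ^ 2 + α * β + β ^ 2 = 1) : α • (pos c - pos b) + β • (pos a - pos b) ≠ 0 := by
  intro h0
  obtain ⟨rfl, rfl⟩ := LinearIndependent.pair_iff.1 (hG.linearIndependent ha) α β h0
  norm_num at h

theorem IsChart.wsum_eq (hG : IsChart G pos) {a b c d : V} (had : a ≠ d) (ha : {a, b, c} ∈ M.faces)
    (hd : {d, b, c} ∈ M.faces) (haG : {a, b, c} ∈ G) {x : V → ℝ}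
    (hx : x ∈ disk {a, b, c} ∪ disk {d, b, c}) (hdG : x d = 0 ∨ {d, b, c} ∈ G) : wsum pos x =
      pos b + (x c + x d) • (pos c - pos b) + (x a - x d) • (pos a - pos b) := by
  have hsum := (rhombus_coords had ha hd hx).2.2.2.2
  rw [wsum_rhombus pos had ha hd hx, show x b = 1 - x a - x c - x d by linarith]
  rcases hdG with hxd | hdG
  · rw [hxd]
    module
  · rw [eq_sub_of_add_eq' (hG.rhombus had haG hdG)]
    module

theorem IsChart.locallyStraightAt_of_mem_disk (hG : IsChart G pos) {a b c d : V} (had : a ≠ d)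
    (ha : {a, b, c} ∈ M.faces) (hd : {d, b, c} ∈ M.faces) (haG : {a, b, c} ∈ G)
    (hdG : γ t ∈ disk {d, b, c} → {d, b, c} ∈ G) (hmem : γ t ∈ disk {a, b, c}) {z w α β : ℝ}
    (hαβ : α ^ 2 + α * β + β ^ 2 = 1) (h : ∀ᶠ s in 𝓝 (0 : ℝ),
      γ (t + s) ∈ disk {a, b, c} ∪ disk {d, b, c} ∧
      γ (t + s) c + γ (t + s) d = z + s * α ∧ γ (t + s) a - γ (t + s) d = w + s * β) :
    LocallyStraightAt (fun t => wsum pos (γ t)) t := by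
  have hflat : ∀ᶠ s in 𝓝 (0 : ℝ), wsum pos (γ (t + s)) = pos b +
      (z + s * α) • (pos c - pos b) + (w + s * β) • (pos a - pos b) := by
    have hxd : ∀ᶠ s in 𝓝 (0 : ℝ), γ (t + s) d = 0 ∨ {d, b, c} ∈ G := by
      rcases (hmem.1 a).eq_or_lt with hxa | hxa
      · exact .of_forall fun _ => .inr (hdG (mem_disk_of_eq_zero ha hd hmem hxa.symm))
      obtain ⟨-, -, h0⟩ := h.self_of_nhds
      rw [add_zero, zero_mul, add_zero, eq_zero_of_pos had ha hd (.inl hmem) hxa, sub_zero] at h0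
      have hpos : ∀ᶠ s in 𝓝 (0 : ℝ), 0 < w + s * β :=
        ContinuousAt.eventually_lt (by fun_prop) (by fun_prop) (by simpa [← h0] using hxa)
      filter_upwards [h, hpos] with s ⟨hs, _, had'⟩ hs'
      obtain ⟨-, -, -, hxd, -⟩ := rhombus_coords had ha hd hs
      exact .inl (by rw [hxd, max_eq_left (by linarith)])
    filter_upwards [h, hxd] with s ⟨hs, hcd, had'⟩ hs'
    rw [hG.wsum_eq had ha hd haG hs hs', hcd, had']
  refine ⟨α • (pos c - pos b) + β • (pos a - pos b), hG.add_ne_zero haG hαβ, ?_⟩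
  filter_upwards [hflat] with s hs
  have h0 := hflat.self_of_nhds
  rw [add_zero] at h0
  rw [hs, h0]
  module

theorem StraightAt.locallyStraightAt (hG : IsChart G pos) (h : M.StraightAt γ t)
    (ht : ∀ f ∈ M.faces, γ t ∈ disk f → f ∈ G) :
    LocallyStraightAt (fun t => wsum pos (γ t)) t := by
  obtain ⟨a, b, c, d, had, ha, hd, z, w, α, β, hαβ, h⟩ := straightAt_iff.1 h
  have hmem := h.self_of_nhds.1
  rw [add_zero] at hmem
  rcases hmem with hmem | hmem
  · exact hG.locallyStraightAt_of_mem_disk had ha hd (ht _ ha hmem) (ht _ hd) hmem hαβ h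
  · refine hG.locallyStraightAt_of_mem_disk had.symm hd ha (ht _ hd hmem) (ht _ ha) hmem
      (z := z + w) (w := -w) (α := α + β) (β := -β) (by linarith) ?_
    filter_upwards [h] with s ⟨hs, hcd, had'⟩
    exact ⟨hs.symm, by linarith, by linarith⟩

theorem IsChart.sub_eq_of_isLinkCycle (hG : IsChart G pos) {p : V} {n : ℕ} {w : ZMod n → V}
    (hw : IsLinkCycle M.faces p w) (hp : ∀ f ∈ M.faces, p ∈ f → f ∈ G) (hn : ¬ n ∣ 2)
    (i : ZMod n) : pos (w (i + 2)) - pos p = (pos (w (i + 1)) - pos p) - (pos (w i) - pos p) := by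
  have hmem (i : ZMod n) : {p, w i, w (i + 1)} ∈ G := hp _ (hw.mem i) (by simp)
  have h1 := hmem (i + 1)
  have h0 := hmem i
  rw [show i + 1 + 1 = i + 2 by ring] at h1
  have hne : w (i + 2) ≠ w i := fun h =>
    hn ((ZMod.natCast_eq_zero_iff 2 n).1 (by simpa using hw.injective h))
  have := hG.rhombus (a := w (i + 2)) (b := p) (c := w (i + 1)) (d := w i) hne
    (by convert h1 using 1; grind) (by convert h0 using 1; grind)
  rw [eq_sub_of_add_eq this]
  abel

theorem exp_neg_pi_div_three_mul_I :
    Complex.exp ((-(Real.pi / 3) : ℝ) * Complex.I) = 1 - ζ := by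
  rw [← conj_ζ, ζ, ← Complex.exp_conj, map_mul, Complex.conj_I, Complex.conj_ofReal]
  push_cast
  ring_nf

theorem IsChart.add_eq_neg_of_turn (hG : IsChart G pos) {p : V} {w : ZMod 6 → V}
    (hw : IsLinkCycle M.faces p w) (hp : ∀ f ∈ M.faces, p ∈ f → f ∈ G) {k : ℕ} (hk : 2 ≤ k)
    (hk' : k ≤ 4) {A B A' B' : ℝ} (hA : 0 ≤ A) (hB : 0 ≤ B) (hA' : 0 ≤ A') (hB' : 0 ≤ B')
    (hturn : (A' + B' * ζ : ℂ) =
      (A + B * ζ) * Complex.exp (((6 - 2 * k : ℝ) * (Real.pi / 6) : ℝ) * Complex.I)) :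
    A' • (pos (w k) - pos p) + B' • (pos (w (k + 1)) - pos p) =
      -(A • (pos (w 0) - pos p) + B • (pos (w 1) - pos p)) := by
  have hstep := hG.sub_eq_of_isLinkCycle hw hp (by norm_num)
  have h2 := hstep 0
  have h3 := hstep 1
  have h4 := hstep 2
  rw [show (0 + 2 : ZMod 6) = 2 by decide, show (0 + 1 : ZMod 6) = 1 by decide] at h2
  rw [show (1 + 2 : ZMod 6) = 3 by decide, show (1 + 1 : ZMod 6) = 2 by decide, h2] at h3
  rw [show (2 + 2 : ZMod 6) = 4 by decide, show (2 + 1 : ZMod 6) = 3 by decide, h3, h2] at h4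
  have hζ : Complex.exp ((Real.pi / 3 : ℝ) * Complex.I) = ζ := rfl
  interval_cases k
  · rw [show ((6 - 2 * (2 : ℕ)) * (Real.pi / 6) : ℝ) = Real.pi / 3 by push_cast; ring, hζ,
      show (A + B * ζ : ℂ) * ζ = (-B : ℝ) + (A + B : ℝ) * ζ by
        push_cast; linear_combination (B : ℂ) * ζ_mul_ζ, add_mul_ζ_inj] at hturn
    obtain rfl : B = 0 := by linarith
    obtain ⟨rfl, rfl⟩ := hturn
    rw [show (((2 : ℕ) : ZMod 6) + 1) = 3 by decide, h3]
    module
  · rw [show ((6 - 2 * (3 : ℕ)) * (Real.pi / 6) : ℝ) = 0 by push_cast; ring, Complex.ofReal_zero,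
      zero_mul, Complex.exp_zero, mul_one, add_mul_ζ_inj] at hturn
    obtain ⟨rfl, rfl⟩ := hturn
    rw [show (((3 : ℕ) : ZMod 6) + 1) = 4 by decide, Nat.cast_ofNat, h3, h4]
    module
  · rw [show ((6 - 2 * (4 : ℕ)) * (Real.pi / 6) : ℝ) = -(Real.pi / 3) by push_cast; ring,
      exp_neg_pi_div_three_mul_I, show (A + B * ζ : ℂ) * (1 - ζ) = (A + B : ℝ) + (-A : ℝ) * ζ by
        push_cast; linear_combination (-B : ℂ) * ζ_mul_ζ, add_mul_ζ_inj] at hturn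
    obtain rfl : A = 0 := by linarith
    obtain ⟨rfl, rfl⟩ := hturn
    rw [show (((4 : ℕ) : ZMod 6) + 1) = 5 by decide, Nat.cast_ofNat, h4]
    module

theorem BisectsAt.locallyStraightAt (hG : IsChart G pos) (h : M.BisectsAt γ t)
    (ht : ∀ f ∈ M.faces, γ t ∈ disk f → f ∈ G)
    (hdeg : ∀ v, γ t = Pi.single v 1 → M.IsEuclideanVertex v) :
    LocallyStraightAt (fun t => wsum pos (γ t)) t := by
  obtain ⟨p, w, hw, hp, k, hk, hk', A, B, A', B', hA, hB, hA', hB', hnorm, hturn, ε, hε, h⟩ :=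
    h.exists_rays pos
  have hdeg6 : M.degree p = 6 := hdeg p hp
  have hpG : ∀ f ∈ M.faces, p ∈ f → f ∈ G := fun f hf hpf => ht f hf (hp ▸ single_mem_disk hpf)
  generalize M.degree p = n at *
  subst hdeg6
  have hturn' := hG.add_eq_neg_of_turn hw hpG (k := k) (by omega) (by omega) hA hB hA' hB'
    (mod_cast hturn)
  have hface : {w 0, p, w 1} ∈ G := by
    convert hpG _ (hw.mem 0) (by simp) using 1
    rw [zero_add]
    grind
  have hne := hG.add_ne_zero hface (α := B) (β := A) (by linarith)
  rw [add_comm] at hne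
  refine ⟨_, hne, ?_⟩
  filter_upwards [Ioo_mem_nhds (neg_lt_zero.2 hε) hε] with s hs
  rw [hp, wsum_single]
  rcases le_total 0 s with h0 | h0
  · exact (h s h0 hs.2).1
  · rw [← sub_neg_eq_add, (h (-s) (by linarith) (by linarith [hs.1])).2, hturn']
    module

end SManifold

section LinkCycle

variable {V : Type*} [DecidableEq V] {F : Set (Finset V)} {v : V} {n : ℕ} {w : ZMod n → V}

theorem IsLinkCycle.ne_center (hF : ∀ f ∈ F, f.card = 3) (h : IsLinkCycle F v w) (i : ZMod n) :
    v ≠ w i :=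
  (SManifold.ne_of_card_triple (hF _ (h.mem i))).1

theorem IsLinkCycle.eq_or_eq_add_one_of_mem (hF : ∀ f ∈ F, f.card = 3) (h : IsLinkCycle F v w)
    {i j : ZMod n} (hij : w i ∈ ({v, w j, w (j + 1)} : Finset V)) : i = j ∨ i = j + 1 := by
  simpa [(h.ne_center hF i).symm, h.injective.eq_iff] using hij

theorem IsLinkCycle.face_injective (hF : ∀ f ∈ F, f.card = 3) (hn : 3 ≤ n)
    (h : IsLinkCycle F v w) :
    Function.Injective fun i : ZMod n => ({v, w i, w (i + 1)} : Finset V) := by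
  intro i j hij
  dsimp only at hij
  rcases h.eq_or_eq_add_one_of_mem hF (i := i) (j := j) (by simp [← hij]) with rfl | hi
  · rfl
  rcases h.eq_or_eq_add_one_of_mem hF (i := i + 1) (j := j) (by simp [← hij]) with hj | hj
  · have h2 : ((2 : ℕ) : ZMod n) = 0 := by push_cast; linear_combination hj - hi
    have := Nat.le_of_dvd two_pos ((ZMod.natCast_eq_zero_iff 2 n).1 h2)
    omega
  · exact add_right_cancel hj

theorem IsLinkCycle.ncard_eq (hF : ∀ f ∈ F, f.card = 3) (hn : 3 ≤ n) (h : IsLinkCycle F v w) :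
    {f ∈ F | v ∈ f}.ncard = n := by
  have : {f ∈ F | v ∈ f} = Set.range fun i : ZMod n => ({v, w i, w (i + 1)} : Finset V) := by
    ext f
    rw [Set.mem_ofPred_eq, h.faces_iff, Set.mem_range]
    simp only [eq_comm]
  rw [this, ← Set.image_univ, Set.ncard_image_of_injective _ (h.face_injective hF hn),
    Set.ncard_univ, Nat.card_zmod]

theorem IsLinkCycle.ncard_edge_eq_two (hF : ∀ f ∈ F, f.card = 3) (hn : 3 ≤ n)
    (h : IsLinkCycle F v w) (i : ZMod n) : {f ∈ F | {v, w i} ⊆ f}.ncard = 2 := by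
  refine Set.ncard_eq_two.2
    ⟨{v, w i, w (i + 1)}, {v, w (i - 1), w (i - 1 + 1)}, fun he => ?_, ?_⟩
  · have h1 : ((1 : ℕ) : ZMod n) = 0 := by
      push_cast; linear_combination h.face_injective hF hn he
    have := Nat.le_of_dvd one_pos ((ZMod.natCast_eq_zero_iff 1 n).1 h1)
    omega
  · ext f
    simp only [Set.mem_ofPred_eq, Set.mem_insert_iff, Set.mem_singleton_iff,
      Finset.insert_subset_iff, Finset.singleton_subset_iff]
    refine ⟨fun ⟨hf, hvf, hif⟩ => ?_, ?_⟩
    · obtain ⟨j, rfl⟩ := (h.faces_iff f).1 ⟨hf, hvf⟩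
      rcases h.eq_or_eq_add_one_of_mem hF hif with rfl | rfl
      · exact .inl rfl
      · exact .inr (by rw [add_sub_cancel_right])
    · rintro (rfl | rfl)
      · exact ⟨h.mem i, by simp, by simp⟩
      · exact ⟨h.mem (i - 1), by simp, by simp⟩

theorem IsLinkCycle.exists_eq (h : IsLinkCycle F v w) {f : Finset V} (hf : f ∈ F) (hv : v ∈ f)
    {u : V} (hu : u ∈ f) (huv : u ≠ v) : ∃ i, u = w i := by
  obtain ⟨i, rfl⟩ := (h.faces_iff f).1 ⟨hf, hv⟩
  simp only [Finset.mem_insert, Finset.mem_singleton, huv, false_or] at hu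
  exact hu.elim (fun h => ⟨_, h⟩) fun h => ⟨_, h⟩

theorem eq_add_or_eq_sub_of_step [NeZero n] {φ : ZMod n → ZMod n} (hφ : Function.Injective φ)
    (hn : ¬ n ∣ 2) (hstep : ∀ i, φ (i + 1) = φ i + 1 ∨ φ (i + 1) = φ i - 1) :
    (∀ i, φ i = φ 0 + i) ∨ ∀ i, φ i = φ 0 - i := by
  have hne (i : ZMod n) : φ (i + 1 + 1) ≠ φ i := fun h => hn <| by
    rw [← ZMod.natCast_eq_zero_iff]
    push_cast
    linear_combination hφ h
  have hup (h : φ (0 + 1) = φ 0 + 1) (k : ℕ) : φ (k + 1) = φ k + 1 := by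
    induction k with
    | zero => simpa using h
    | succ k ih =>
      push_cast
      refine (hstep (k + 1)).resolve_right fun h => hne k ?_
      rw [h, ih, add_sub_cancel_right]
  have hdown (h : φ (0 + 1) = φ 0 - 1) (k : ℕ) : φ (k + 1) = φ k - 1 := by
    induction k with
    | zero => simpa using h
    | succ k ih =>
      push_cast
      refine (hstep (k + 1)).resolve_left fun h => hne k ?_
      rw [h, ih, sub_add_cancel]
  refine (hstep 0).imp (fun h i => ?_) fun h i => ?_
  all_goals
    obtain ⟨k, rfl⟩ := ZMod.natCast_zmod_surjective i
    induction k with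
    | zero => simp
    | succ k ih =>
      push_cast
      first | rw [hup h, ih] | rw [hdown h, ih]
      ring

theorem IsLinkCycle.eq_add_or_eq_sub [NeZero n] {m : ZMod n → V} (hF : ∀ f ∈ F, f.card = 3)
    (hn : ¬ n ∣ 2) (hw : IsLinkCycle F v w) (hm : IsLinkCycle F v m) :
    ∃ c, (∀ i, w i = m (c + i)) ∨ ∀ i, w i = m (c - i) := by
  have hex (i) : ∃ j, w i = m j :=
    hm.exists_eq (hw.mem i) (by simp) (by simp) (hw.ne_center hF i).symm
  choose φ hφ using hex
  have hinj : Function.Injective φ := fun i j h => hw.injective (by rw [hφ, hφ, h])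
  refine ⟨φ 0, (eq_add_or_eq_sub_of_step hinj hn fun i => ?_).imp
    (fun h i => by rw [hφ, h]) fun h i => by rw [hφ, h]⟩
  obtain ⟨j, hj⟩ := (hm.faces_iff _).1 ⟨hw.mem i, by simp⟩
  have hi : φ i = j ∨ φ i = j + 1 :=
    hm.eq_or_eq_add_one_of_mem hF (by rw [← hφ, ← hj]; simp)
  have hi' : φ (i + 1) = j ∨ φ (i + 1) = j + 1 :=
    hm.eq_or_eq_add_one_of_mem hF (by rw [← hφ, ← hj]; simp)
  have hne : φ (i + 1) ≠ φ i := fun h => hn <| by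
    have : ((1 : ℕ) : ZMod n) = 0 := by push_cast; linear_combination hinj h
    exact ((ZMod.natCast_eq_zero_iff 1 n).1 this).trans (one_dvd 2)
  rcases hi with hi | hi <;> rcases hi' with hi' | hi' <;> rw [hi, hi'] at hne ⊢ <;> simp at hne ⊢

end LinkCycle

namespace SManifold

variable {V : Type*} [DecidableEq V]

/-- The S-manifold with the triangles `F`, from cycles of five, six or seven of them around every
vertex; the condition on the edges follows. -/
def ofLinkCycles (F : Set (Finset V)) (hF : ∀ f ∈ F, f.card = 3) (n : V → ℕ)
    (hn : ∀ v, n v ∈ ({5, 6, 7} : Set ℕ)) (hw : ∀ v, ∃ w : ZMod (n v) → V, IsLinkCycle F v w) :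
    SManifold V :=
  have h3 (v) : 3 ≤ n v := by rcases hn v with h | h | h <;> rw [h] <;> norm_num
  have hcard (v) : {f ∈ F | v ∈ f}.ncard = n v := (hw v).elim fun _ h => h.ncard_eq hF (h3 v)
  { faces := F
    card_face := hF
    edge_shared := fun f hf e hef he => by
      obtain ⟨v, u, hvu, rfl⟩ := Finset.card_eq_two.1 he
      obtain ⟨w, h⟩ := hw v
      obtain ⟨i, rfl⟩ := h.exists_eq hf (hef (by simp)) (hef (by simp)) hvu.symm
      exact h.ncard_edge_eq_two hF (h3 v) i
    vertex_shared := fun v => by rw [hcard]; exact hn v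
    link_cycle := fun v => by rw [hcard]; exact hw v }

variable {M : SManifold V} {γ : ℝ → V → ℝ} {t : ℝ}

section Realization

theorem comp_mem_disk {V : Type*} (σ : Equiv.Perm V) {f : Finset V} {x : V → ℝ} (hx : x ∈ disk f) :
    x ∘ σ ∈ disk (f.map σ.symm.toEmbedding) := by
  refine ⟨fun v => hx.1 _, fun v hv => hx.2.1 _ fun h => hv ?_, ?_⟩
  · exact Finset.mem_map.2 ⟨σ v, h, by simp⟩
  · simpa using hx.2.2

theorem StraightAt.comp (h : M.StraightAt γ t) (σ : Equiv.Perm V)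
    (hσ : ∀ f ∈ M.faces, f.map σ.symm.toEmbedding ∈ M.faces) :
    M.StraightAt (fun t => γ t ∘ σ) t := by
  obtain ⟨a, b, c, d, had, ha, hd, z, u, hu, ε, hε, h⟩ := h
  have hmap (p q r : V) : ({p, q, r} : Finset V).map σ.symm.toEmbedding =
      {σ.symm p, σ.symm q, σ.symm r} := by simp
  refine ⟨σ.symm a, σ.symm b, σ.symm c, σ.symm d, by simpa using had, hmap a b c ▸ hσ _ ha,
    hmap d b c ▸ hσ _ hd, z, u, hu, ε, hε, fun s hs => ⟨?_, ?_⟩⟩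
  · rw [← hmap, ← hmap]
    exact (h s hs).1.imp (comp_mem_disk σ) (comp_mem_disk σ)
  · simpa [unfold] using (h s hs).2

variable {E : Type*} [AddCommGroup E] [Module ℝ E]

theorem degree_ne_zero (M : SManifold V) (v : V) : M.degree v ≠ 0 := by
  rcases M.vertex_shared v with h | h | h <;> rw [degree, h] <;> norm_num

theorem finite_star (M : SManifold V) (v : V) : {f ∈ M.faces | v ∈ f}.Finite :=
  Set.finite_of_ncard_ne_zero (M.degree_ne_zero v)

theorem single_mem_points (M : SManifold V) (v : V) : Pi.single v 1 ∈ M.points := by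
  obtain ⟨f, hf, hv⟩ := Set.nonempty_of_ncard_ne_zero (M.degree_ne_zero v)
  exact ⟨f, hf, single_mem_disk hv⟩

theorem continuous_wsum [TopologicalSpace E] [ContinuousAdd E] [ContinuousSMul ℝ E] (g : V → E) :
    Continuous fun x : M.points => wsum g x := by
  rw [continuous_iff_continuousAt]
  rintro ⟨x, f, hf, hx⟩
  obtain ⟨v, -, hxv⟩ : ∃ v ∈ f, 0 < x v :=
    Finset.exists_lt_of_sum_lt (by simp [hx.2.2])
  let N : Finset V := (M.finite_star v).toFinset.biUnion id
  have hval (u : V) : Continuous fun y : M.points => y.1 u :=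
    (continuous_apply u).comp continuous_subtype_val
  have hc : Continuous fun y : M.points => ∑ u ∈ N, y.1 u • g u :=
    continuous_finsetSum _ fun u _ => (hval u).smul continuous_const
  have hpos : ∀ᶠ y : M.points in 𝓝 ⟨x, f, hf, hx⟩, 0 < y.1 v :=
    (hval v).continuousAt.eventually (lt_mem_nhds hxv)
  refine hc.continuousAt.congr ?_
  filter_upwards [hpos] with ⟨y, k, hk, hyk⟩ hy
  have hsupp {u : V} (hu : y u ≠ 0) : u ∈ k := by_contra fun h => hu (hyk.2.1 u h)
  refine (finsum_eq_sum_of_support_subset _ fun u hu => ?_).symm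
  simp only [N, Finset.coe_biUnion, Set.mem_iUnion]
  exact ⟨k, by simpa using ⟨hk, hsupp hy.ne'⟩, hsupp (left_ne_zero_of_smul hu)⟩

end Realization

section Chart

variable {E : Type*} [AddCommGroup E] [Module ℝ E] {G : Set (Finset V)} {pos : V → E}

theorem IsGeodesic.mem_points (hγ : M.IsGeodesic γ) (t : ℝ) : γ t ∈ M.points := by
  rcases hγ t with h | ⟨p, w, hw, α, -, β, -, k, -, -, ε, hε, h⟩
  · exact h.mem_points
  · have hmem := (h 0 le_rfl hε).1.1
    rw [add_zero] at hmem
    exact ⟨_, by simpa using hw.mem 0, hmem⟩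

theorem IsGeodesic.locallyStraightAt (hγ : M.IsGeodesic γ) (hG : IsChart G pos)
    (ht : ∀ f ∈ M.faces, γ t ∈ disk f → f ∈ G)
    (hdeg : ∀ v, γ t = Pi.single v 1 → M.IsEuclideanVertex v) :
    LocallyStraightAt (fun t => wsum pos (γ t)) t :=
  (hγ t).elim (fun h => h.locallyStraightAt hG ht) fun h => h.locallyStraightAt hG ht hdeg

theorem exists_edge_of_mem_disk {f : Finset V} (hf : f.card = 3) {x : V → ℝ} (hx : x ∈ disk f)
    (hx' : ∀ v, x ≠ Pi.single v 1) : ∃ a b c, f = {a, b, c} ∧ 0 < x b ∧ 0 < x c := by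
  obtain ⟨p, q, r, -, -, -, rfl⟩ := Finset.card_eq_three.1 hf
  obtain ⟨hp, hq, hr, -, hsum⟩ := (mem_disk_triple hf).1 hx
  have hne (v : V) : x v ≠ 1 := fun hv => hx' v (eq_single_of_mem_disk hx hv)
  rcases hp.eq_or_lt with hp | hp
  · exact ⟨p, q, r, rfl, hq.lt_of_ne' fun h => hne r (by linarith),
      hr.lt_of_ne' fun h => hne q (by linarith)⟩
  rcases hq.eq_or_lt with hq | hq
  · exact ⟨q, p, r, by grind, hp, hr.lt_of_ne' fun h => hne p (by linarith)⟩
  · exact ⟨r, p, q, by grind, hp, hq⟩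

theorem exists_opposite (M : SManifold V) {a b c : V} (hf : {a, b, c} ∈ M.faces) :
    ∃ d ≠ a, {d, b, c} ∈ M.faces ∧
      ∀ g ∈ M.faces, b ∈ g → c ∈ g → g = {a, b, c} ∨ g = {d, b, c} := by
  obtain ⟨_, _, hbc⟩ := ne_of_card_triple (M.card_face _ hf)
  have htwo := M.edge_shared _ hf {b, c} (by simp) (Finset.card_pair hbc)
  obtain ⟨g, hg, hgf⟩ := Set.exists_ne_of_one_lt_ncard (htwo.symm ▸ one_lt_two) {a, b, c}
  obtain ⟨d, hd⟩ : ∃ d, g \ {b, c} = {d} := by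
    rw [← Finset.card_eq_one, Finset.card_sdiff_of_subset hg.2, M.card_face _ hg.1,
      Finset.card_pair hbc]
  have hgd : g = {d, b, c} := by
    rw [← Finset.sdiff_union_of_subset hg.2, hd]
    rfl
  subst hgd
  refine ⟨d, by grind, hg.1, fun g' hg' hb hc => ?_⟩
  have hpair : {{a, b, c}, {d, b, c}} = {g' ∈ M.faces | {b, c} ⊆ g'} :=
    Set.eq_of_subset_of_ncard_le (by grind) (by rw [htwo, Set.ncard_pair hgf.symm])
      (Set.finite_of_ncard_ne_zero (by rw [htwo]; exact two_ne_zero))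
  have hmem : g' ∈ {g' ∈ M.faces | {b, c} ⊆ g'} := ⟨hg', by grind⟩
  rwa [← hpair] at hmem

theorem IsChart.straightAt (hG : IsChart G pos) (hcont : ContinuousAt γ t)
    (hmem : ∀ᶠ s in 𝓝 (0 : ℝ), γ (t + s) ∈ M.points) (hne : ∀ v, γ t ≠ Pi.single v 1)
    (ht : ∀ f ∈ M.faces, γ t ∈ disk f → f ∈ G) {u : E}
    (hu : ∀ a b c, {a, b, c} ∈ G → ∃ α β : ℝ, α ^ 2 + α * β + β ^ 2 = 1 ∧
      u = α • (pos c - pos b) + β • (pos a - pos b))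
    (hflat : ∀ᶠ s in 𝓝 (0 : ℝ), wsum pos (γ (t + s)) = wsum pos (γ t) + s • u) :
    M.StraightAt γ t := by
  have h0 := hmem.self_of_nhds
  rw [add_zero] at h0
  obtain ⟨f, hf, hx⟩ := h0
  obtain ⟨a, b, c, rfl, hb, hc⟩ := exists_edge_of_mem_disk (M.card_face _ hf) hx hne
  obtain ⟨d, hda, hd, hstar⟩ := M.exists_opposite hf
  obtain ⟨α, β, hαβ, rfl⟩ := hu a b c (ht _ hf hx)
  have hev {v : V} (hv : 0 < γ t v) : ∀ᶠ s in 𝓝 (0 : ℝ), 0 < γ (t + s) v := by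
    have hcomp := (continuous_apply v).continuousAt.comp
      ((continuousAt_comp_add_left_iff _ _).2 hcont)
    exact continuousAt_const.eventually_lt hcomp (by simpa using hv)
  have hdisk : ∀ᶠ s in 𝓝 (0 : ℝ), γ (t + s) ∈ disk {a, b, c} ∪ disk {d, b, c} := by
    filter_upwards [hmem, hev hb, hev hc] with s ⟨g, hg, hs⟩ hsb hsc
    have hmemg {v : V} (hv : 0 < γ (t + s) v) : v ∈ g := by_contra fun h => hv.ne' (hs.2.1 v h)
    rcases hstar g hg (hmemg hsb) (hmemg hsc) with rfl | rfl
    exacts [.inl hs, .inr hs]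
  have hdG : ∀ᶠ s in 𝓝 (0 : ℝ), γ (t + s) d = 0 ∨ {d, b, c} ∈ G := by
    rcases (hx.1 a).eq_or_lt with ha | ha
    · exact .of_forall fun _ => .inr (ht _ hd (mem_disk_of_eq_zero hf hd hx ha.symm))
    · filter_upwards [hdisk, hev ha] with s hs hsa
      exact .inl (eq_zero_of_pos hda.symm hf hd hs hsa)
  refine straightAt_iff.2 ⟨a, b, c, d, hda.symm, hf, hd, γ t c + γ t d, γ t a - γ t d, α, β, hαβ,
    ?_⟩
  filter_upwards [hdisk, hdG, hflat] with s hs hsd hs'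
  have h0d := hdG.self_of_nhds
  rw [add_zero] at h0d
  rw [hG.wsum_eq hda.symm hf hd (ht _ hf hx) hs hsd,
    hG.wsum_eq hda.symm hf hd (ht _ hf hx) (.inl hx) h0d] at hs'
  obtain ⟨hc, ha'⟩ := (hG.linearIndependent (ht _ hf hx)).eq_of_pair
    (s := γ (t + s) c + γ (t + s) d) (t := γ (t + s) a - γ (t + s) d)
    (s' := γ t c + γ t d + s * α) (t' := γ t a - γ t d + s * β)
    (by linear_combination (norm := module) hs')
  exact ⟨hs, hc, ha'⟩

end Chart

end SManifold

namespace SemiParadoxist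

open SManifold

section SquareComplex

variable (T : ℤ × ℤ → Bool)

/-- The triangles of the plane cut into unit squares, and these into two triangles each: the square
with lower left corner `v` is cut by its rising diagonal if `T v`, and by its falling one if not. -/
inductive Face : Finset (ℤ × ℤ) → Prop
  | lower {i j : ℤ} (h : T (i, j) = false) : Face {(i, j), (i + 1, j), (i, j + 1)}
  | upper {i j : ℤ} (h : T (i, j) = false) : Face {(i + 1, j), (i, j + 1), (i + 1, j + 1)}
  | right {i j : ℤ} (h : T (i, j) = true) : Face {(i, j), (i + 1, j), (i + 1, j + 1)}
  | left {i j : ℤ} (h : T (i, j) = true) : Face {(i, j), (i, j + 1), (i + 1, j + 1)}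

variable {T}

theorem Face.card_eq {f : Finset (ℤ × ℤ)} (hf : Face T f) : f.card = 3 := by
  cases hf <;> exact Finset.card_eq_three.2 ⟨_, _, _, by simp, by simp, by simp, rfl⟩

/-- The edges opposite to the vertex `0` of the triangles around it, counterclockwise, when the
diagonals of the first to the fourth quadrant are rising or not according to `b₁, …, b₄`. -/
def linkEdges (b₁ b₂ b₃ b₄ : Bool) : Finset ((ℤ × ℤ) × ℤ × ℤ) :=
  (if b₁ then {((1, 0), (1, 1)), ((1, 1), (0, 1))} else {((1, 0), (0, 1))}) ∪
  (if b₂ then {((0, 1), (-1, 0))} else {((0, 1), (-1, 1)), ((-1, 1), (-1, 0))}) ∪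
  (if b₃ then {((-1, 0), (-1, -1)), ((-1, -1), (0, -1))} else {((-1, 0), (0, -1))}) ∪
  (if b₄ then {((0, -1), (1, 0))} else {((0, -1), (1, -1)), ((1, -1), (1, 0))})

theorem Face.exists_linkEdges {f : Finset (ℤ × ℤ)} (hf : Face T f) {v : ℤ × ℤ} (hv : v ∈ f) :
    ∃ p ∈ linkEdges (T v) (T (v - (1, 0))) (T (v - (1, 1))) (T (v - (0, 1))),
      f = {v, v + p.1, v + p.2} := by
  cases hf <;> simp only [Finset.mem_insert, Finset.mem_singleton] at hv <;>
    rcases hv with rfl | rfl | rfl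
  on_goal 1 => refine ⟨((1, 0), (0, 1)), ?_⟩
  on_goal 2 => refine ⟨((-1, 1), (-1, 0)), ?_⟩
  on_goal 3 => refine ⟨((0, -1), (1, -1)), ?_⟩
  on_goal 4 => refine ⟨((0, 1), (-1, 1)), ?_⟩
  on_goal 5 => refine ⟨((1, -1), (1, 0)), ?_⟩
  on_goal 6 => refine ⟨((-1, 0), (0, -1)), ?_⟩
  on_goal 7 => refine ⟨((1, 0), (1, 1)), ?_⟩
  on_goal 8 => refine ⟨((0, 1), (-1, 0)), ?_⟩
  on_goal 9 => refine ⟨((-1, -1), (0, -1)), ?_⟩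
  on_goal 10 => refine ⟨((1, 1), (0, 1)), ?_⟩
  on_goal 11 => refine ⟨((0, -1), (1, 0)), ?_⟩
  on_goal 12 => refine ⟨((-1, 0), (-1, -1)), ?_⟩
  all_goals exact ⟨by simp [linkEdges, *], by ext ⟨k, l⟩; simp <;> omega⟩

theorem face_of_mem_linkEdges {v : ℤ × ℤ} {p : (ℤ × ℤ) × ℤ × ℤ}
    (hp : p ∈ linkEdges (T v) (T (v - (1, 0))) (T (v - (1, 1))) (T (v - (0, 1)))) :
    Face T {v, v + p.1, v + p.2} := by
  obtain ⟨i, j⟩ := v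
  have of_eq {f g : Finset (ℤ × ℤ)} (hf : Face T f) (h : f = g) : Face T g := h ▸ hf
  rw [linkEdges, Finset.mem_union, Finset.mem_union, Finset.mem_union] at hp
  simp only [Prod.mk_sub_mk, sub_zero] at hp
  rcases hp with ((hp | hp) | hp) | hp <;> split at hp <;> rename_i h <;>
    try rw [Bool.not_eq_true] at h
  all_goals
    simp only [Finset.mem_insert, Finset.mem_singleton] at hp
    rcases hp with rfl | rfl
  on_goal 1 => refine of_eq (.right h) ?_
  on_goal 2 => refine of_eq (.left h) ?_
  on_goal 3 => refine of_eq (.lower h) ?_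
  on_goal 4 => refine of_eq (.right h) ?_
  on_goal 5 => refine of_eq (.upper h) ?_
  on_goal 6 => refine of_eq (.lower h) ?_
  on_goal 7 => refine of_eq (.left h) ?_
  on_goal 8 => refine of_eq (.right h) ?_
  on_goal 9 => refine of_eq (.upper h) ?_
  on_goal 10 => refine of_eq (.left h) ?_
  on_goal 11 => refine of_eq (.lower h) ?_
  on_goal 12 => refine of_eq (.upper h) ?_
  all_goals ext ⟨k, l⟩; simp <;> omega

theorem isLinkCycle {v : ℤ × ℤ} {n : ℕ} [NeZero n] {c : ZMod n → ℤ × ℤ}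
    (hc : Function.Injective c)
    (h : linkEdges (T v) (T (v - (1, 0))) (T (v - (1, 1))) (T (v - (0, 1))) =
      Finset.univ.image fun i => (c i, c (i + 1))) :
    IsLinkCycle {f | Face T f} v fun i => v + c i where
  injective := (add_right_injective v).comp hc
  faces_iff f := by
    refine ⟨fun ⟨hf, hv⟩ => ?_, ?_⟩
    · obtain ⟨p, hp, rfl⟩ := hf.exists_linkEdges hv
      rw [h] at hp
      obtain ⟨i, -, rfl⟩ := Finset.mem_image.1 hp
      exact ⟨i, rfl⟩
    · rintro ⟨i, rfl⟩
      exact ⟨face_of_mem_linkEdges (p := (c i, c (i + 1))) (h ▸ Finset.mem_image_of_mem _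
        (Finset.mem_univ i)), by simp⟩

end SquareComplex

section Model

/-- The squares of the model with a rising diagonal: the left half of one row. -/
def turned (v : ℤ × ℤ) : Bool := v.2 = 0 ∧ v.1 < 0

/-- The neighbours of the elliptic vertex, counterclockwise. -/
def ellipticLink : ZMod 5 → ℤ × ℤ := ![(1, 0), (0, 1), (-1, 0), (0, -1), (1, -1)]

theorem isLinkCycle_ellipticLink :
    IsLinkCycle {f | Face turned f} (0, 0) fun i => (0, 0) + ellipticLink i :=
  isLinkCycle (by decide) (by decide)

/-- The neighbours of the hyperbolic vertex, counterclockwise. -/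
def hyperbolicLink : ZMod 7 → ℤ × ℤ :=
  ![(1, 0), (0, 1), (-1, 1), (-1, 0), (-1, -1), (0, -1), (1, -1)]

theorem isLinkCycle_hyperbolicLink :
    IsLinkCycle {f | Face turned f} (0, 1) fun i => (0, 1) + hyperbolicLink i :=
  isLinkCycle (by decide) (by decide)

/-- The neighbours of a vertex with rising diagonals above it, below it, or nowhere around it. -/
def euclideanLink (above below : Bool) : ZMod 6 → ℤ × ℤ :=
  if above then ![(1, 0), (1, 1), (0, 1), (-1, 0), (0, -1), (1, -1)]
  else if below then ![(1, 0), (0, 1), (-1, 1), (-1, 0), (-1, -1), (0, -1)]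
  else ![(1, 0), (0, 1), (-1, 1), (-1, 0), (0, -1), (1, -1)]

theorem isLinkCycle_euclideanLink {v : ℤ × ℤ} (h0 : v ≠ (0, 0)) (h1 : v ≠ (0, 1)) :
    IsLinkCycle {f | Face turned f} v
      fun i => v + euclideanLink (turned v) (turned (v - (0, 1))) i := by
  have hlink : ∀ above below : Bool, ¬ (above = true ∧ below = true) →
      Function.Injective (euclideanLink above below) ∧ linkEdges above above below below =
        Finset.univ.image fun i =>
          (euclideanLink above below i, euclideanLink above below (i + 1)) := by
    decide
  have hleft : turned (v - (1, 0)) = turned v ∧ turned (v - (1, 1)) = turned (v - (0, 1)) ∧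
      ¬ (turned v = true ∧ turned (v - (0, 1)) = true) := by
    obtain ⟨i, j⟩ := v
    simp only [turned, ne_eq, Prod.mk.injEq, Prod.mk_sub_mk, decide_eq_decide,
      decide_eq_true_eq] at h0 h1 ⊢
    omega
  obtain ⟨hinj, hedges⟩ := hlink _ _ hleft.2.2
  exact isLinkCycle hinj (by rw [hleft.1, hleft.2.1, hedges])

theorem exists_isLinkCycle (v : ℤ × ℤ) :
    ∃ w : ZMod (if v = (0, 0) then 5 else if v = (0, 1) then 7 else 6) → ℤ × ℤ,
      IsLinkCycle {f | Face turned f} v w := by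
  rcases eq_or_ne v (0, 0) with rfl | h0
  · exact ⟨_, isLinkCycle_ellipticLink⟩
  rcases eq_or_ne v (0, 1) with rfl | h1
  · exact ⟨_, isLinkCycle_hyperbolicLink⟩
  rw [if_neg h0, if_neg h1]
  exact ⟨_, isLinkCycle_euclideanLink h0 h1⟩

/-- The model: the elliptic vertex is the origin and the hyperbolic one lies above it, the ends
of the row of rising diagonals. -/
def model : SManifold (ℤ × ℤ) :=
  ofLinkCycles {f | Face turned f} (fun _ hf => hf.card_eq)
    (fun v => if v = (0, 0) then 5 else if v = (0, 1) then 7 else 6)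
    (fun v => by split_ifs <;> simp) exists_isLinkCycle

theorem degree_model (v : ℤ × ℤ) :
    model.degree v = if v = (0, 0) then 5 else if v = (0, 1) then 7 else 6 := by
  obtain ⟨w, hw⟩ := exists_isLinkCycle v
  exact hw.ncard_eq (fun _ hf => hf.card_eq) (by split_ifs <;> norm_num)

end Model

section Plane

/-- The position of a vertex of the square lattice in the plane. -/
def position (v : ℤ × ℤ) : ℝ × ℝ := (v.1, v.2)

/-- The linear forms `m` such that the star of the vertex `0` consists of the points at which all of
them are at most one, with diagonals as in `linkEdges`. -/
def linkForms (b₁ b₂ b₃ b₄ : Bool) : Finset (ℤ × ℤ) :=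
  {(1, 0), (-1, 0), (0, 1), (0, -1)} ∪ (if b₁ then ∅ else {(1, 1)}) ∪
  (if b₂ then {(-1, 1)} else ∅) ∪ (if b₃ then ∅ else {(-1, -1)}) ∪ (if b₄ then {(1, -1)} else ∅)

theorem linkForms_nonempty (b₁ b₂ b₃ b₄ : Bool) : (linkForms b₁ b₂ b₃ b₄).Nonempty :=
  ⟨(1, 0), by simp [linkForms]⟩

theorem linkForms_linkEdges {b₁ b₂ b₃ b₄ : Bool} {p : (ℤ × ℤ) × ℤ × ℤ}
    (hp : p ∈ linkEdges b₁ b₂ b₃ b₄) :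
    (∃ m ∈ linkForms b₁ b₂ b₃ b₄,
      m.1 * p.1.1 + m.2 * p.1.2 = 1 ∧ m.1 * p.2.1 + m.2 * p.2.2 = 1) ∧
    ∀ m ∈ linkForms b₁ b₂ b₃ b₄,
      m.1 * p.1.1 + m.2 * p.1.2 ≤ 1 ∧ m.1 * p.2.1 + m.2 * p.2.2 ≤ 1 := by
  revert b₁ b₂ b₃ b₄ p
  decide

variable (T : ℤ × ℤ → Bool)

/-- The piecewise linear function on the plane that is zero at the vertex `v` and one on the
boundary of its star. -/
noncomputable def gauge (v : ℤ × ℤ) (p : ℝ × ℝ) : ℝ :=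
  (linkForms (T v) (T (v - (1, 0))) (T (v - (1, 1))) (T (v - (0, 1)))).sup'
    (linkForms_nonempty _ _ _ _) fun m => m.1 * (p.1 - v.1) + m.2 * (p.2 - v.2)

/-- The point of the complex over a point of the plane, in barycentric coordinates. -/
noncomputable def hat (p : ℝ × ℝ) (v : ℤ × ℤ) : ℝ := max 0 (1 - gauge T v p)

theorem continuous_hat : Continuous (hat T) :=
  continuous_pi fun _ => continuous_const.max <| continuous_const.sub <|
    Continuous.finset_sup'_apply _ fun _ _ => by fun_prop

variable {T} {f : Finset (ℤ × ℤ)} {x : ℤ × ℤ → ℝ} {v : ℤ × ℤ}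

theorem form_wsum_position (hx : x ∈ disk f) (v m : ℤ × ℤ) :
    m.1 * ((wsum position x).1 - v.1) + m.2 * ((wsum position x).2 - v.2) =
      ∑ w ∈ f, x w * (m.1 * (w.1 - v.1) + m.2 * (w.2 - v.2) : ℤ) := by
  have hv : position v = ∑ w ∈ f, x w • position v := by rw [← Finset.sum_smul, hx.2.2, one_smul]
  have hsub : wsum position x - position v = ∑ w ∈ f, x w • (position w - position v) := by
    simp only [smul_sub, Finset.sum_sub_distrib, ← hv, wsum_of_mem_disk position hx]
  have h₁ := congrArg Prod.fst hsub
  have h₂ := congrArg Prod.snd hsub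
  simp only [Prod.fst_sub, Prod.snd_sub, Prod.fst_sum, Prod.snd_sum, Prod.smul_fst, Prod.smul_snd,
    smul_eq_mul, position] at h₁ h₂
  rw [h₁, h₂, Finset.mul_sum, Finset.mul_sum, ← Finset.sum_add_distrib]
  refine Finset.sum_congr rfl fun w _ => ?_
  push_cast
  ring

theorem Face.gauge_of_mem (hf : Face T f) (hx : x ∈ disk f) (hv : v ∈ f) :
    gauge T v (wsum position x) = 1 - x v := by
  obtain ⟨⟨a, b⟩, hp, rfl⟩ := hf.exists_linkEdges hv
  obtain ⟨⟨m, hm, hma, hmb⟩, hle⟩ := linkForms_linkEdges hp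
  have hsum := hx.2.2
  rw [sum_triple hf.card_eq] at hsum
  have hform (m : ℤ × ℤ) : m.1 * ((wsum position x).1 - v.1) + m.2 * ((wsum position x).2 - v.2) =
      x (v + a) * (m.1 * a.1 + m.2 * a.2 : ℤ) + x (v + b) * (m.1 * b.1 + m.2 * b.2 : ℤ) := by
    rw [form_wsum_position hx, sum_triple hf.card_eq]
    simp
  refine le_antisymm (Finset.sup'_le _ _ fun m hm => ?_) ?_
  · have ha : ((m.1 * a.1 + m.2 * a.2 : ℤ) : ℝ) ≤ 1 := mod_cast (hle m hm).1
    have hb : ((m.1 * b.1 + m.2 * b.2 : ℤ) : ℝ) ≤ 1 := mod_cast (hle m hm).2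
    rw [hform]
    linarith [mul_le_of_le_one_right (hx.1 (v + a)) ha, mul_le_of_le_one_right (hx.1 (v + b)) hb]
  · refine le_trans (le_of_eq ?_) (Finset.le_sup' _ hm)
    rw [hform, hma, hmb]
    push_cast
    linarith

theorem Face.exists_linkForms (hf : Face T f) (hv : v ∉ f) :
    ∃ m ∈ linkForms (T v) (T (v - (1, 0))) (T (v - (1, 1))) (T (v - (0, 1))),
      ∀ w ∈ f, 1 ≤ m.1 * (w.1 - v.1) + m.2 * (w.2 - v.2) := by
  have hbox (i j : ℤ) (hf : ∀ w ∈ f, (w.1 = i ∨ w.1 = i + 1) ∧ (w.2 = j ∨ w.2 = j + 1))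
      (h : v.1 < i ∨ i + 1 < v.1 ∨ v.2 < j ∨ j + 1 < v.2) :
      ∃ m ∈ linkForms (T v) (T (v - (1, 0))) (T (v - (1, 1))) (T (v - (0, 1))),
        ∀ w ∈ f, 1 ≤ m.1 * (w.1 - v.1) + m.2 * (w.2 - v.2) := by
    rcases h with h | h | h | h
    · exact ⟨(1, 0), by simp [linkForms], fun w hw => by grind⟩
    · exact ⟨(-1, 0), by simp [linkForms], fun w hw => by grind⟩
    · exact ⟨(0, 1), by simp [linkForms], fun w hw => by grind⟩
    · exact ⟨(0, -1), by simp [linkForms], fun w hw => by grind⟩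
  cases hf with
  | @lower i j h =>
    by_cases hv' : v = (i + 1, j + 1)
    · subst hv'
      exact ⟨(-1, -1), by simp [linkForms, h], by simp⟩
    · exact hbox i j (by simp) (by grind)
  | @upper i j h =>
    by_cases hv' : v = (i, j)
    · subst hv'
      exact ⟨(1, 1), by simp [linkForms, h], by simp⟩
    · exact hbox i j (by simp) (by grind)
  | @right i j h =>
    by_cases hv' : v = (i, j + 1)
    · subst hv'
      exact ⟨(1, -1), by simp [linkForms, h], by simp⟩
    · exact hbox i j (by simp) (by grind)
  | @left i j h =>
    by_cases hv' : v = (i + 1, j)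
    · subst hv'
      exact ⟨(-1, 1), by simp [linkForms, h], by simp⟩
    · exact hbox i j (by simp) (by grind)

theorem Face.one_le_gauge (hf : Face T f) (hx : x ∈ disk f) (hv : v ∉ f) :
    1 ≤ gauge T v (wsum position x) := by
  obtain ⟨m, hm, hle⟩ := hf.exists_linkForms hv
  refine le_trans ?_ (Finset.le_sup' _ hm)
  rw [form_wsum_position hx, ← hx.2.2]
  exact Finset.sum_le_sum fun w hw => le_mul_of_one_le_right (hx.1 w) (mod_cast hle w hw)

theorem Face.hat_wsum_position (hf : Face T f) (hx : x ∈ disk f) :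
    hat T (wsum position x) = x := by
  ext v
  rw [hat]
  by_cases hv : v ∈ f
  · rw [hf.gauge_of_mem hx hv, sub_sub_cancel, max_eq_right (hx.1 v)]
  · rw [hx.2.1 v hv, max_eq_left (by linarith [hf.one_le_gauge hx hv])]

theorem Face.hat_mem_disk {a b c : ℤ × ℤ} (hf : Face T {a, b, c}) {α β δ : ℝ} (hα : 0 ≤ α)
    (hβ : 0 ≤ β) (hδ : 0 ≤ δ) (h : α + β + δ = 1) {p : ℝ × ℝ}
    (hp : α • position a + β • position b + δ • position c = p) :
    hat T p ∈ disk {a, b, c} ∧ wsum position (hat T p) = p := by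
  obtain ⟨x, hx, hxp⟩ := exists_mem_disk_wsum_eq position hf.card_eq hα hβ hδ h
  rw [hp] at hxp
  rw [← hxp, hf.hat_wsum_position hx]
  exact ⟨hx, rfl⟩

theorem exists_face_hat (T : ℤ × ℤ → Bool) (p : ℝ × ℝ) :
    ∃ f, Face T f ∧ hat T p ∈ disk f ∧ wsum position (hat T p) = p := by
  have hx₀ := Int.fract_nonneg p.1
  have hx₁ := (Int.fract_lt_one p.1).le
  have hy₀ := Int.fract_nonneg p.2
  have hy₁ := (Int.fract_lt_one p.2).le
  have hx := Int.floor_add_fract p.1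
  have hy := Int.floor_add_fract p.2
  cases h : T (⌊p.1⌋, ⌊p.2⌋)
  · rcases le_total (Int.fract p.1 + Int.fract p.2) 1 with hs | hs
    · refine ⟨_, .lower h, (Face.lower h).hat_mem_disk (sub_nonneg.2 hs) hx₀ hy₀ (by ring) ?_⟩
      ext <;> simp [position] <;> linarith
    · refine ⟨_, .upper h, (Face.upper h).hat_mem_disk (sub_nonneg.2 hy₁) (sub_nonneg.2 hx₁)
        (sub_nonneg.2 hs) (by ring) ?_⟩
      ext <;> simp [position] <;> linarith
  · rcases le_total (Int.fract p.2) (Int.fract p.1) with hs | hs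
    · refine ⟨_, .right h, (Face.right h).hat_mem_disk (sub_nonneg.2 hx₁) (sub_nonneg.2 hs)
        hy₀ (by ring) ?_⟩
      ext <;> simp [position] <;> linarith
    · refine ⟨_, .left h, (Face.left h).hat_mem_disk (sub_nonneg.2 hy₁) (sub_nonneg.2 hs)
        hx₀ (by ring) ?_⟩
      ext <;> simp [position] <;> linarith

theorem wsum_position_hat (T : ℤ × ℤ → Bool) (p : ℝ × ℝ) : wsum position (hat T p) = p := by
  obtain ⟨f, -, -, h⟩ := exists_face_hat T p
  exact h

/-- The point of the model over a point of the plane. -/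
noncomputable def pt (p : ℝ × ℝ) : ℤ × ℤ → ℝ := hat turned p

theorem pt_mem_points (p : ℝ × ℝ) : pt p ∈ model.points := by
  obtain ⟨f, hf, h, -⟩ := exists_face_hat turned p
  exact ⟨f, hf, h⟩

theorem wsum_position_pt (p : ℝ × ℝ) : wsum position (pt p) = p := wsum_position_hat turned p

theorem pt_wsum_position {x : ℤ × ℤ → ℝ} (hx : x ∈ model.points) : pt (wsum position x) = x := by
  obtain ⟨f, hf, hx⟩ := hx
  exact hf.hat_wsum_position hx

theorem pt_position (v : ℤ × ℤ) : pt (position v) = Pi.single v 1 := by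
  rw [← wsum_single position v, pt_wsum_position (model.single_mem_points v)]

/-- The model is the plane cut into triangles. -/
noncomputable def planeHomeo : model.points ≃ₜ EuclideanSpace ℝ (Fin 2) where
  toFun x := !₂[(wsum position x.1).1, (wsum position x.1).2]
  invFun p := ⟨pt (p 0, p 1), pt_mem_points _⟩
  left_inv x := Subtype.ext (pt_wsum_position x.2)
  right_inv p := by
    ext i
    fin_cases i <;> simp [wsum_position_pt]
  continuous_toFun := by
    have h := continuous_wsum (M := model) position
    fun_prop
  continuous_invFun := ((continuous_hat turned).comp (by fun_prop)).subtype_mk _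

theorem isModel_model : model.IsModel (0, 1) (0, 0) where
  plane := ⟨planeHomeo⟩
  hyperbolic := by rw [IsHyperbolicVertex, degree_model]; rfl
  elliptic := by rw [IsEllipticVertex, degree_model]; rfl
  adjacent := ⟨by decide, _, Face.lower (i := 0) (j := 0) rfl, by simp, by simp⟩
  euclidean v h0 h1 := by rw [IsEuclideanVertex, degree_model, if_neg h1, if_neg h0]

end Plane

section Chart

theorem Face.sub_mem {a b c : ℤ × ℤ} (hf : Face (fun _ => false) {a, b, c}) :
    (c - b, a - b) ∈ linkEdges false false false false ∪
      (linkEdges false false false false).image Prod.swap := by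
  obtain ⟨⟨u, w⟩, hp, h⟩ := hf.exists_linkEdges (v := b) (by simp)
  obtain ⟨hab, hac, hbc⟩ := ne_of_card_triple hf.card_eq
  have ha : a ∈ ({b, b + u, b + w} : Finset (ℤ × ℤ)) := h ▸ by simp
  have hc : c ∈ ({b, b + u, b + w} : Finset (ℤ × ℤ)) := h ▸ by simp
  simp only [Finset.mem_insert, Finset.mem_singleton, hab, hbc.symm, false_or] at ha hc
  rw [Finset.mem_union, Finset.mem_image]
  rcases ha with rfl | rfl <;> rcases hc with rfl | rfl
  · exact absurd rfl hac
  · exact Or.inr ⟨_, hp, by simp⟩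
  · exact Or.inl (by simpa using hp)
  · exact absurd rfl hac

theorem isChart_position : IsChart {f | Face (fun _ => false) f} position where
  linearIndependent a b c hf := by
    have hdet : ∀ p ∈ linkEdges false false false false ∪
        (linkEdges false false false false).image Prod.swap,
        p.1.1 * p.2.2 - p.1.2 * p.2.1 ≠ 0 := by decide
    have h := hdet _ (Face.sub_mem hf)
    have h' : ((c.1 - b.1) * (a.2 - b.2) - (c.2 - b.2) * (a.1 - b.1) : ℝ) ≠ 0 := mod_cast h
    rw [LinearIndependent.pair_iff]
    intro s t hst
    have h₁ := congrArg Prod.fst hst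
    have h₂ := congrArg Prod.snd hst
    simp only [position, Prod.fst_add, Prod.smul_fst, Prod.fst_sub, Prod.snd_add, Prod.smul_snd,
      Prod.snd_sub, smul_eq_mul, Prod.fst_zero, Prod.snd_zero] at h₁ h₂
    constructor
    · refine (mul_eq_zero.1 ?_).resolve_right h'
      linear_combination (a.2 - b.2 : ℝ) * h₁ - (a.1 - b.1 : ℝ) * h₂
    · refine (mul_eq_zero.1 ?_).resolve_right h'
      linear_combination (c.1 - b.1 : ℝ) * h₂ - (c.2 - b.2 : ℝ) * h₁
  rhombus a b c d had ha hd := by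
    have hrhombus : ∀ p ∈ linkEdges false false false false ∪
        (linkEdges false false false false).image Prod.swap,
        ∀ q ∈ linkEdges false false false false ∪
        (linkEdges false false false false).image Prod.swap,
        p.1 = q.1 → p.2 ≠ q.2 → p.2 + q.2 = p.1 := by decide
    have h := hrhombus _ (Face.sub_mem ha) _ (Face.sub_mem hd) rfl (by simpa using had)
    have h' : a + d = b + c := by linear_combination h
    have h₁ : (a.1 + d.1 : ℝ) = b.1 + c.1 := mod_cast congrArg Prod.fst h'
    have h₂ : (a.2 + d.2 : ℝ) = b.2 + c.2 := mod_cast congrArg Prod.snd h'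
    exact Prod.ext h₁ h₂

/-- The part of the plane in which the model looks like the plane: the complement of the squares
with a rising diagonal. -/
def flatRegion : Set (ℝ × ℝ) := (Set.Iic 0 ×ˢ Set.Icc 0 1)ᶜ

theorem mem_flatRegion_iff {p : ℝ × ℝ} : p ∈ flatRegion ↔ 0 < p.1 ∨ p.2 < 0 ∨ 1 < p.2 := by
  simp only [flatRegion, Set.mem_compl_iff, Set.mem_prod, Set.mem_Iic, Set.mem_Icc]
  grind

theorem face_of_wsum_mem_flatRegion {f : Finset (ℤ × ℤ)} (hf : Face turned f) {x : ℤ × ℤ → ℝ}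
    (hx : x ∈ disk f) (h : wsum position x ∈ flatRegion) : Face (fun _ => false) f := by
  have hmem (hv : ∀ v ∈ f, v.1 ≤ 0 ∧ 0 ≤ v.2 ∧ v.2 ≤ 1) : False := by
    rw [wsum_of_mem_disk position hx] at h
    refine h (((convex_Iic 0).prod (convex_Icc 0 1)).sum_mem (fun v _ => hx.1 v) hx.2.2
      fun v hvf => ?_)
    simp only [position, Set.mem_prod, Set.mem_Iic, Set.mem_Icc]
    exact_mod_cast hv v hvf
  cases hf with
  | lower => exact .lower rfl
  | upper => exact .upper rfl
  | right hT | left hT =>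
    simp only [turned, decide_eq_true_eq] at hT
    refine (hmem ?_).elim
    simp only [Finset.mem_insert, Finset.mem_singleton]
    rintro v (rfl | rfl | rfl) <;> simp <;> omega

theorem locallyStraightAt_wsum_position {γ : ℝ → ℤ × ℤ → ℝ} (hγ : model.IsGeodesic γ) {t : ℝ}
    (ht : wsum position (γ t) ∈ flatRegion) :
    LocallyStraightAt (fun t => wsum position (γ t)) t := by
  refine hγ.locallyStraightAt isChart_position (fun f hf hx => face_of_wsum_mem_flatRegion hf hx ht)
    fun v hv => ?_
  rw [hv, wsum_single] at ht
  rw [IsEuclideanVertex, degree_model, if_neg, if_neg] <;> rintro rfl <;>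
    norm_num [mem_flatRegion_iff, position] at ht

end Chart

section FlatCurves

variable {γ : ℝ → ℤ × ℤ → ℝ} {t : ℝ} {p u : ℝ × ℝ}

theorem position_sub (v w : ℤ × ℤ) : position (v - w) = position v - position w := by
  simp [position]

theorem exists_eq_smul_sub {a b c : ℤ × ℤ} (hf : Face (fun _ => false) {a, b, c})
    (hu : u.1 ^ 2 + u.1 * u.2 + u.2 ^ 2 = 1) : ∃ α β : ℝ, α ^ 2 + α * β + β ^ 2 = 1 ∧
      u = α • (position c - position b) + β • (position a - position b) := by
  have hgram : ∀ p ∈ linkEdges false false false false ∪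
      (linkEdges false false false false).image Prod.swap,
      (p.1.1 * p.2.2 - p.1.2 * p.2.1) ^ 2 = 1 ∧ p.1.1 ^ 2 + p.1.1 * p.1.2 + p.1.2 ^ 2 = 1 ∧
      p.2.1 ^ 2 + p.2.1 * p.2.2 + p.2.2 ^ 2 = 1 ∧
      2 * p.1.1 * p.2.1 + p.1.1 * p.2.2 + p.1.2 * p.2.1 + 2 * p.1.2 * p.2.2 = 1 := by decide
  have h := hgram _ hf.sub_mem
  generalize hm : c - b = m, hn : a - b = n at h
  obtain ⟨hdet, hmm, hnn, hmn⟩ : ((m.1 * n.2 - m.2 * n.1 : ℝ) ^ 2 = 1 ∧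
      (m.1 ^ 2 + m.1 * m.2 + m.2 ^ 2 : ℝ) = 1 ∧ (n.1 ^ 2 + n.1 * n.2 + n.2 ^ 2 : ℝ) = 1 ∧
      (2 * m.1 * n.1 + m.1 * n.2 + m.2 * n.1 + 2 * m.2 * n.2 : ℝ) = 1) := by exact_mod_cast h
  rw [← position_sub, ← position_sub, hm, hn]
  obtain ⟨α, hα⟩ : ∃ α : ℝ, α = (m.1 * n.2 - m.2 * n.1) * (u.1 * n.2 - u.2 * n.1) := ⟨_, rfl⟩
  obtain ⟨β, hβ⟩ : ∃ β : ℝ, β = (m.1 * n.2 - m.2 * n.1) * (m.1 * u.2 - m.2 * u.1) := ⟨_, rfl⟩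
  have h1 : u.1 = α * m.1 + β * n.1 := by rw [hα, hβ]; linear_combination -u.1 * hdet
  have h2 : u.2 = α * m.2 + β * n.2 := by rw [hα, hβ]; linear_combination -u.2 * hdet
  refine ⟨α, β, ?_, Prod.ext h1 h2⟩
  rw [h1, h2] at hu
  linear_combination hu - α ^ 2 * hmm - β ^ 2 * hnn - α * β * hmn

theorem straightAt_of_eventually_eq_pt (hu : u.1 ^ 2 + u.1 * u.2 + u.2 ^ 2 = 1)
    (hp : p ∈ flatRegion) (hpv : ∀ v, p ≠ position v)
    (h : ∀ᶠ s in 𝓝 (0 : ℝ), γ (t + s) = pt (p + s • u)) : model.StraightAt γ t := by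
  have h0 : γ t = pt p := by simpa using h.self_of_nhds
  have hcont : Continuous fun s : ℝ => pt (p + s • u) := (continuous_hat turned).comp (by fun_prop)
  refine isChart_position.straightAt
    ((continuousAt_comp_add_left_iff _ _).1 (hcont.continuousAt.congr (h.mono fun _ h => h.symm)))
    (h.mono fun s hs => hs ▸ pt_mem_points _) (fun v hv => hpv v ?_) (fun f hf hx => ?_)
    (fun a b c hf => exists_eq_smul_sub hf hu) (h.mono fun s hs => ?_)
  · rw [← wsum_position_pt p, ← h0, hv, wsum_single]
  · exact face_of_wsum_mem_flatRegion hf hx (by rwa [h0, wsum_position_pt])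
  · rw [hs, h0, wsum_position_pt, wsum_position_pt]

theorem wsum_position_add (hγ : model.IsGeodesic γ) {S : ℝ}
    (hS : ∀ s ∈ Set.Ioo 0 S, p + s • u ∈ flatRegion)
    (h0 : ∀ᶠ s in 𝓝[≥] (0 : ℝ), wsum position (γ (t + s)) = p + s • u) {s : ℝ}
    (hs : s ∈ Set.Icc 0 S) : wsum position (γ (t + s)) = p + s • u :=
  eq_ray_of_locallyStraightAt (f := fun t => wsum position (γ t)) (hγ.continuous_wsum position)
    (fun s hs h => locallyStraightAt_wsum_position hγ (h ▸ hS s hs)) h0 hs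

theorem wsum_position_sub (hγ : model.IsGeodesic γ) {S : ℝ}
    (hS : ∀ s ∈ Set.Ioo 0 S, p + s • u ∈ flatRegion)
    (h0 : ∀ᶠ s in 𝓝[≥] (0 : ℝ), wsum position (γ (t - s)) = p + s • u) {s : ℝ}
    (hs : s ∈ Set.Icc 0 S) : wsum position (γ (t - s)) = p + s • u := by
  have hneg (s : ℝ) : -(-t + s) = t - s := by ring
  have h := eq_ray_of_locallyStraightAt (f := fun t => wsum position (γ (-t))) (t := -t)
    ((hγ.continuous_wsum position).comp continuous_neg)
    (fun s hs h => (locallyStraightAt_wsum_position hγ (h ▸ hS s hs)).comp_neg)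
    (by simpa only [hneg] using h0) hs
  simpa only [hneg] using h

end FlatCurves

section Level

/-- The linear form whose level lines contain the line `l` of the theorem and the parallel to it. -/
noncomputable def level : ℝ × ℝ →ₗ[ℝ] ℝ := (3 : ℝ) • LinearMap.fst ℝ ℝ ℝ + LinearMap.snd ℝ ℝ ℝ

theorem level_apply (p : ℝ × ℝ) : level p = 3 * p.1 + p.2 := rfl

theorem mem_flatRegion_of_one_lt_level {p : ℝ × ℝ} (hp : 1 < level p) : p ∈ flatRegion := by
  rw [level_apply] at hp
  rw [mem_flatRegion_iff]
  by_contra! h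
  linarith [h.1, h.2.1, h.2.2]

/-- The part of the model on which `level` takes the value `c`. -/
def levelLine (c : ℝ) : Set (ℤ × ℤ → ℝ) := {x ∈ model.points | level (wsum position x) = c}

variable {γ : ℝ → ℤ × ℤ → ℝ} {t c : ℝ} {p u : ℝ × ℝ}

theorem pt_mem_levelLine : pt p ∈ levelLine (level p) :=
  ⟨pt_mem_points p, by rw [wsum_position_pt]⟩

theorem exists_eq_add_smul {q : ℝ × ℝ} (hu : u ≠ 0) (h : level u = 0) (hq : level q = level p) :
    ∃ s : ℝ, q = p + s • u := by
  rw [level_apply] at h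
  rw [level_apply, level_apply] at hq
  have hu1 : u.1 ≠ 0 := fun h1 => hu (Prod.ext h1 (by simpa [h1] using h))
  refine ⟨(q.1 - p.1) / u.1, Prod.ext ?_ ?_⟩
  · change q.1 = p.1 + (q.1 - p.1) / u.1 * u.1
    field_simp
    ring
  · change q.2 = p.2 + (q.1 - p.1) / u.1 * u.2
    field_simp
    linear_combination u.1 * hq - (q.1 - p.1) * h

theorem range_pt_eq_levelLine (p : ℝ × ℝ) (hu : u ≠ 0) (h : level u = 0) :
    Set.range (fun t : ℝ => pt (p + t • u)) = levelLine (level p) := by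
  ext x
  constructor
  · rintro ⟨t, rfl⟩
    have := pt_mem_levelLine (p := p + t • u)
    rwa [map_add, map_smul, h, smul_zero, add_zero] at this
  · rintro ⟨hx, hlevel⟩
    obtain ⟨s, hs⟩ := exists_eq_add_smul hu h hlevel
    exact ⟨s, by rw [← pt_wsum_position hx, hs]⟩

theorem isLine_levelLine (hc : 1 < c) (hcz : ∀ n : ℤ, c ≠ n) : model.IsLine (levelLine c) := by
  have h7 : (√7)⁻¹ ^ 2 = 1 / 7 := by rw [inv_pow, Real.sq_sqrt (by norm_num), one_div]
  have h0 : (√7)⁻¹ ≠ 0 := fun h => by norm_num [h] at h7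
  let u : ℝ × ℝ := (-(√7)⁻¹, 3 * (√7)⁻¹)
  have hu : level u = 0 := by rw [level_apply]; ring
  refine ⟨fun t => pt ((0, c) + t • u), fun t => .inl ?_, ?_⟩
  · have ht : level ((0, c) + t • u) = c := by
      rw [map_add, map_smul, hu, level_apply]
      simp
    refine straightAt_of_eventually_eq_pt (p := (0, c) + t • u) (u := u) ?_
      (mem_flatRegion_of_one_lt_level (by rwa [ht])) (fun v hv => hcz (3 * v.1 + v.2) ?_)
      (.of_forall fun s => by congr 1; module)
    · linear_combination 7 * h7
    · rw [← ht, hv, level_apply, position]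
      push_cast
      rfl
  · rw [range_pt_eq_levelLine _ (fun h => h0 ?_) hu, level_apply]
    · simp
    · simpa [u] using congrArg Prod.fst h

theorem not_disjoint_levelLine (hγ : model.IsGeodesic γ) (h : level (wsum position (γ t)) = c) :
    ¬ Disjoint (Set.range γ) (levelLine c) :=
  Set.not_disjoint_iff.2 ⟨γ t, ⟨t, rfl⟩, hγ.mem_points t, h⟩

theorem exists_level_add_smul_eq (hc : 1 < c) (hcp : c < level p) (hu : level u < 0) :
    ∃ S : ℝ, 0 ≤ S ∧ level (p + S • u) = c ∧ ∀ s ∈ Set.Ioo 0 S, p + s • u ∈ flatRegion := by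
  refine ⟨(level p - c) / -level u, div_nonneg (by linarith) (by linarith), ?_,
    fun s hs => mem_flatRegion_of_one_lt_level ?_⟩
  · rw [map_add, map_smul, smul_eq_mul, div_neg, neg_mul, div_mul_cancel₀ _ hu.ne]
    ring
  · rw [map_add, map_smul, smul_eq_mul]
    linarith [(lt_div_iff₀ (neg_pos.2 hu)).1 hs.2]

/-- A line that is not a level line near a point descends on one of its two sides, and down to level
one it cannot turn. -/
theorem level_eq_zero_of_disjoint (hγ : model.IsGeodesic γ) (hc : 1 < c) (hcp : c < level p)
    (hadd : ∀ᶠ s in 𝓝[≥] (0 : ℝ), wsum position (γ (t + s)) = p + s • u)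
    (hsub : ∀ᶠ s in 𝓝[≥] (0 : ℝ), wsum position (γ (t - s)) = p + s • -u)
    (hdisj : Disjoint (Set.range γ) (levelLine c)) : level u = 0 := by
  rcases lt_trichotomy (level u) 0 with h | h | h
  · obtain ⟨S, hS0, hS, hflat⟩ := exists_level_add_smul_eq hc hcp h
    refine (not_disjoint_levelLine hγ (t := t + S) ?_ hdisj).elim
    rw [wsum_position_add hγ hflat hadd ⟨hS0, le_rfl⟩, hS]
  · exact h
  · obtain ⟨S, hS0, hS, hflat⟩ :=
      exists_level_add_smul_eq hc hcp (u := -u) (by rwa [map_neg, neg_lt_zero])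
    refine (not_disjoint_levelLine hγ (t := t - S) ?_ hdisj).elim
    rw [wsum_position_sub hγ hflat hsub ⟨hS0, le_rfl⟩, hS]

theorem eq_levelLine_of_disjoint {m : Set (ℤ × ℤ → ℝ)} (hm : model.IsLine m) (hc : 1 < c)
    {c' : ℝ} (hcc' : c < c') {x : ℤ × ℤ → ℝ} (hx : x ∈ m) (hxc' : x ∈ levelLine c')
    (hdisj : Disjoint m (levelLine c)) : m = levelLine c' := by
  obtain ⟨γ, hγ, rfl⟩ := hm
  obtain ⟨t, rfl⟩ := hx
  change model.IsGeodesic γ at hγ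
  obtain ⟨-, rfl⟩ := hxc'
  obtain ⟨u, hu0, hu⟩ :=
    locallyStraightAt_wsum_position hγ (mem_flatRegion_of_one_lt_level (hc.trans hcc'))
  have hadd := hu.filter_mono (nhdsWithin_le_nhds (s := Set.Ici 0))
  have hsub : ∀ᶠ s in 𝓝[≥] (0 : ℝ), wsum position (γ (t - s)) = wsum position (γ t) + s • -u := by
    have := (continuous_neg.tendsto' (0 : ℝ) 0 neg_zero).eventually hu
    filter_upwards [this.filter_mono nhdsWithin_le_nhds] with s hs
    rw [sub_eq_add_neg, hs, neg_smul, smul_neg]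
  have hlevel : level u = 0 := level_eq_zero_of_disjoint hγ hc hcc' hadd hsub hdisj
  have hflat (s : ℝ) {v : ℝ × ℝ} (hv : level v = 0) : wsum position (γ t) + s • v ∈ flatRegion :=
    mem_flatRegion_of_one_lt_level (by rw [map_add, map_smul, hv]; simpa using hc.trans hcc')
  have hγ' (s : ℝ) : γ (t + s) = pt (wsum position (γ t) + s • u) := by
    rw [← pt_wsum_position (hγ.mem_points _)]
    congr 1
    rcases le_total 0 s with hs | hs
    · exact wsum_position_add hγ (fun s _ => hflat s hlevel) hadd ⟨hs, le_rfl⟩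
    · have := wsum_position_sub hγ (fun s _ => hflat s (by rw [map_neg, hlevel, neg_zero])) hsub
        ⟨neg_nonneg.2 hs, le_rfl⟩
      rwa [sub_neg_eq_add, smul_neg, neg_smul, neg_neg] at this
  rw [← range_pt_eq_levelLine _ hu0 hlevel, ← funext hγ']
  exact ((Equiv.addLeft t).surjective.range_comp γ).symm

end Level

section EllipticPoint

theorem sqrt_three_mul_exp_pi_div_six_mul_I :
    (√3 : ℂ) * Complex.exp ((Real.pi / 6 : ℝ) * Complex.I) = 1 + ζ := by
  rw [Complex.exp_mul_I, ← Complex.ofReal_cos, ← Complex.ofReal_sin, Real.cos_pi_div_six,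
    Real.sin_pi_div_six, ζ_eq]
  have h3 : √3 * √3 = 3 := Real.mul_self_sqrt (by norm_num)
  apply Complex.ext
  · simp
    linarith
  · simp
    ring

theorem sqrt_three_mul_exp_neg_pi_div_six_mul_I :
    (√3 : ℂ) * Complex.exp ((-(Real.pi / 6) : ℝ) * Complex.I) = 2 - ζ := by
  have h := congrArg (starRingEnd ℂ) sqrt_three_mul_exp_pi_div_six_mul_I
  rw [map_mul, Complex.conj_ofReal, ← Complex.exp_conj, map_mul, Complex.conj_I,
    Complex.conj_ofReal, map_add, map_one, conj_ζ] at h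
  push_cast at h ⊢
  rw [neg_mul, ← mul_neg, h]
  ring

theorem turn_at_elliptic {k : ℕ} (hk : 5 ≤ 2 * k + 2) (hk' : 2 * k ≤ 5 + 2) {A B A' B' : ℝ}
    (hturn : (A' + B' * ζ : ℂ) =
      (A + B * ζ) * Complex.exp ((((5 : ℕ) - 2 * k : ℝ) * (Real.pi / 6) : ℝ) * Complex.I)) :
    k = 2 ∧ √3 * A' = A - B ∧ √3 * B' = A + 2 * B ∨
      k = 3 ∧ √3 * A' = 2 * A + B ∧ √3 * B' = B - A := by
  obtain rfl | rfl : k = 2 ∨ k = 3 := by omega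
  · rw [show (((5 : ℕ) - 2 * (2 : ℕ)) * (Real.pi / 6) : ℝ) = Real.pi / 6 by push_cast; ring]
      at hturn
    refine .inl ⟨rfl, add_mul_ζ_inj.1 ?_⟩
    push_cast
    linear_combination (√3 : ℂ) * hturn + (A + B * ζ : ℂ) * sqrt_three_mul_exp_pi_div_six_mul_I +
      (B : ℂ) * ζ_mul_ζ
  · rw [show (((5 : ℕ) - 2 * (3 : ℕ)) * (Real.pi / 6) : ℝ) = -(Real.pi / 6) by push_cast; ring]
      at hturn
    refine .inr ⟨rfl, add_mul_ζ_inj.1 ?_⟩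
    push_cast
    linear_combination (√3 : ℂ) * hturn +
      (A + B * ζ : ℂ) * sqrt_three_mul_exp_neg_pi_div_six_mul_I - (B : ℂ) * ζ_mul_ζ

theorem exists_ellipticLink_one_sub {m : ZMod 5 → ℤ × ℤ} {c : ZMod 5}
    (hm : (∀ i, m i = ellipticLink (c + i)) ∨ ∀ i, m i = ellipticLink (c - i)) :
    ∃ c', (∀ i, m (1 - i) = ellipticLink (c' + i)) ∨ ∀ i, m (1 - i) = ellipticLink (c' - i) := by
  rcases hm with hm | hm
  · exact ⟨c + 1, .inr fun i => by rw [hm, add_sub_assoc]⟩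
  · exact ⟨c - 1, .inl fun i => by rw [hm, sub_sub_eq_add_sub, sub_add_eq_add_sub]⟩

theorem ellipticLink_quadruple_mem {m : ZMod 5 → ℤ × ℤ} {c : ZMod 5}
    (hm : (∀ i, m i = ellipticLink (c + i)) ∨ ∀ i, m i = ellipticLink (c - i)) :
    [m 0, m 1, m 2, m 3] ∈
      [[(1, 0), (0, 1), (-1, 0), (0, -1)], [(0, 1), (-1, 0), (0, -1), (1, -1)],
      [(-1, 0), (0, -1), (1, -1), (1, 0)], [(0, -1), (1, -1), (1, 0), (0, 1)],
      [(1, -1), (1, 0), (0, 1), (-1, 0)], [(1, 0), (1, -1), (0, -1), (-1, 0)],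
      [(1, -1), (0, -1), (-1, 0), (0, 1)], [(0, -1), (-1, 0), (0, 1), (1, 0)],
      [(-1, 0), (0, 1), (1, 0), (1, -1)], [(0, 1), (1, 0), (1, -1), (0, -1)]] := by
  rcases hm with h | h <;> simp only [h] <;> clear h <;> revert c <;> decide

/-- Directions that lead from the elliptic vertex to `levelLine c`, for positive `c`, without
leaving `flatRegion`. -/
def IsAscending (u : ℝ × ℝ) : Prop := (0 < u.1 ∨ u.2 < 0) ∧ 0 < level u

theorem isAscending_smul_iff {r : ℝ} (hr : 0 < r) {u : ℝ × ℝ} :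
    IsAscending (r • u) ↔ IsAscending u := by
  simp only [IsAscending, map_smul, Prod.smul_fst, Prod.smul_snd, smul_pos_iff_of_pos_left hr,
    smul_neg_iff_of_pos_left hr]

theorem isAscending_or_isAscending {m : ZMod 5 → ℤ × ℤ} {c : ZMod 5}
    (hm : (∀ i, m i = ellipticLink (c + i)) ∨ ∀ i, m i = ellipticLink (c - i)) {A B : ℝ}
    (hB : 0 ≤ B) (hBA : B ≤ A) (hA : 0 < A) :
    IsAscending (A • position (m 0) + B • position (m 1)) ∨
      IsAscending ((A - B) • position (m 2) + (A + 2 * B) • position (m 3)) := by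
  have h := ellipticLink_quadruple_mem hm
  clear hm
  generalize m 0 = v₀, m 1 = v₁, m 2 = v₂, m 3 = v₃ at *
  simp only [IsAscending, level_apply, position, Prod.fst_add, Prod.snd_add, Prod.smul_fst,
    Prod.smul_snd, smul_eq_mul]
  fin_cases h <;> push_cast <;> grind

variable {γ : ℝ → ℤ × ℤ → ℝ} {t : ℝ}

theorem exists_isAscending_of_bisectsAt (h : model.BisectsAt γ t)
    (h0 : γ t = Pi.single (0, 0) 1) : ∃ u, IsAscending u ∧
      ((∀ᶠ s in 𝓝[≥] (0 : ℝ), wsum position (γ (t + s)) = 0 + s • u) ∨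
        ∀ᶠ s in 𝓝[≥] (0 : ℝ), wsum position (γ (t - s)) = 0 + s • u) := by
  obtain ⟨p, w, hw, hp, k, hk, hk', A, B, A', B', hA, hB, hA', hB', hnorm, hturn, ε, hε, hray⟩ :=
    h.exists_rays position
  obtain rfl : p = (0, 0) := by
    by_contra hne
    have := congrFun (hp.symm.trans h0) p
    simp [hne] at this
  have hdeg : model.degree (0, 0) = 5 := by simp [degree_model]
  generalize model.degree (0, 0) = n at *
  subst hdeg
  have hev : ∀ᶠ s in 𝓝[≥] (0 : ℝ), 0 ≤ s ∧ s < ε :=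
    Ico_mem_nhdsGE hε
  have hpos : position (0, 0) = 0 := by simp [position]
  simp only [hpos, sub_zero] at hray
  have h3 : 0 < √3 := by positivity
  obtain ⟨c, hc⟩ := IsLinkCycle.eq_add_or_eq_sub (fun _ hf => Face.card_eq hf) (by norm_num) hw
    isLinkCycle_ellipticLink
  simp only [Prod.mk_zero_zero, zero_add] at hc
  suffices hasc : IsAscending (A • position (w 0) + B • position (w 1)) ∨
      IsAscending (√3 • (A' • position (w k) + B' • position (w (k + 1)))) by
    rw [isAscending_smul_iff h3] at hasc
    rcases hasc with hasc | hasc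
    · exact ⟨_, hasc, .inl (hev.mono fun s hs => (hray s hs.1 hs.2).1)⟩
    · exact ⟨_, hasc, .inr (hev.mono fun s hs => (hray s hs.1 hs.2).2)⟩
  rw [smul_add, smul_smul, smul_smul]
  rcases turn_at_elliptic hk hk' hturn with ⟨rfl, hA'', hB''⟩ | ⟨rfl, hA'', hB''⟩
  · rw [hA'', hB'']
    have hBA : B ≤ A := by nlinarith
    exact isAscending_or_isAscending hc hB hBA (by nlinarith)
  · rw [hA'', hB'']
    have hAB : A ≤ B := by nlinarith
    obtain ⟨c', hc'⟩ := exists_ellipticLink_one_sub hc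
    have h : IsAscending (B • position (w 1) + A • position (w 0)) ∨
        IsAscending ((B - A) • position (w 4) + (B + 2 * A) • position (w 3)) :=
      isAscending_or_isAscending hc' hA hAB (by nlinarith)
    rwa [add_comm (B • _), add_comm B, add_comm ((B - A) • _)] at h

theorem parallels_single_eq_empty {c : ℝ} (hc : 0 < c) :
    model.parallels (levelLine c) (Pi.single (0, 0) 1) = ∅ := by
  rw [Set.eq_empty_iff_forall_notMem]
  rintro _ ⟨⟨γ, hγ, rfl⟩, ⟨t, ht⟩, hdisj⟩
  obtain ⟨u, ⟨hflat, hlevel⟩, hu⟩ :=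
    exists_isAscending_of_bisectsAt ((hγ t).resolve_left fun h => h.ne_single _ ht) ht
  have hS : ∀ s ∈ Set.Ioo 0 (c / level u), 0 + s • u ∈ flatRegion := fun s hs => by
    rw [zero_add, mem_flatRegion_iff]
    exact hflat.imp (mul_pos hs.1) fun h => .inl (mul_neg_of_pos_of_neg hs.1 h)
  have hmem : c / level u ∈ Set.Icc 0 (c / level u) := ⟨(div_pos hc hlevel).le, le_rfl⟩
  have hend : level (0 + (c / level u) • u) = c := by
    rw [zero_add, map_smul, smul_eq_mul, div_mul_cancel₀ _ hlevel.ne']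
  rcases hu with hu | hu
  · exact not_disjoint_levelLine hγ (by rw [wsum_position_add hγ hS hu hmem, hend]) hdisj
  · exact not_disjoint_levelLine hγ (by rw [wsum_position_sub hγ hS hu hmem, hend]) hdisj

end EllipticPoint

section Reflection

/-- The reflection of the model in the line through the elliptic and the hyperbolic vertex. -/
def reflection : Equiv.Perm (ℤ × ℤ) :=
  Function.Involutive.toPerm (fun v => ((if 1 ≤ v.2 then 1 else 0) - v.1 - v.2, v.2)) fun v =>
    Prod.ext (by dsimp only; ring) rfl

theorem reflection_apply (v : ℤ × ℤ) :
    reflection v = ((if 1 ≤ v.2 then 1 else 0) - v.1 - v.2, v.2) := rfl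

theorem reflection_symm : reflection.symm = reflection := rfl

theorem map_reflection_mem_faces {f : Finset (ℤ × ℤ)} (hf : f ∈ model.faces) :
    f.map reflection.symm.toEmbedding ∈ model.faces := by
  have of_eq {g : Finset (ℤ × ℤ)} (hg : Face turned g)
      (h : f.map reflection.symm.toEmbedding = g) :
      f.map reflection.symm.toEmbedding ∈ model.faces := h ▸ hg
  rcases hf with @⟨i, j, h⟩ | @⟨i, j, h⟩ | @⟨i, j, h⟩ | @⟨i, j, h⟩
  on_goal 1 => rcases lt_trichotomy j 0 with hj | hj | hj
  on_goal 4 => rcases lt_trichotomy j 0 with hj | hj | hj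
  on_goal 1 => refine of_eq (.lower (i := -i - j - 1) (j := j) ?_) ?_
  on_goal 3 => refine of_eq (.right (i := -i - 1) (j := j) ?_) ?_
  on_goal 5 => refine of_eq (.lower (i := -i - j) (j := j) ?_) ?_
  on_goal 7 => refine of_eq (.upper (i := -i - j - 2) (j := j) ?_) ?_
  on_goal 9 => refine of_eq (.left (i := -i - 1) (j := j) ?_) ?_
  on_goal 11 => refine of_eq (.upper (i := -i - j - 1) (j := j) ?_) ?_
  on_goal 13 => refine of_eq (.lower (i := -i - 1) (j := j) ?_) ?_
  on_goal 15 => refine of_eq (.upper (i := -i - 1) (j := j) ?_) ?_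
  all_goals simp only [turned, decide_eq_true_eq, decide_eq_false_iff_not] at h ⊢
  all_goals first
    | omega
    | ext ⟨k, l⟩; simp [reflection_symm, reflection_apply]; split_ifs <;> omega

theorem wsum_comp_reflection {f : Finset (ℤ × ℤ)} {x : ℤ × ℤ → ℝ} (hx : x ∈ disk f) :
    wsum position (x ∘ reflection) = ∑ v ∈ f, x v • position (reflection v) := by
  rw [wsum_of_mem_disk position (comp_mem_disk reflection hx), Finset.sum_map]
  refine Finset.sum_congr rfl fun v _ => ?_
  rw [Function.comp_apply, Equiv.coe_toEmbedding, Equiv.apply_symm_apply, reflection_symm]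

theorem wsum_comp_reflection_snd {x : ℤ × ℤ → ℝ} (hx : x ∈ model.points) :
    (wsum position (x ∘ reflection)).2 = (wsum position x).2 := by
  obtain ⟨f, -, hx⟩ := hx
  rw [wsum_comp_reflection hx, wsum_of_mem_disk position hx]
  simp [Prod.snd_sum, position, reflection_apply]

theorem wsum_comp_reflection_fst_le {x : ℤ × ℤ → ℝ} (hx : x ∈ model.points) :
    (wsum position (x ∘ reflection)).1 ≤
      max 0 (min 1 (wsum position x).2) - (wsum position x).1 - (wsum position x).2 := by
  obtain ⟨f, hf, hx⟩ := hx
  have hrows : (∀ v ∈ f, 0 ≤ v.2) ∨ ∀ v ∈ f, v.2 ≤ 0 := by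
    rcases hf with @⟨i, j, -⟩ | @⟨i, j, -⟩ | @⟨i, j, -⟩ | @⟨i, j, -⟩ <;> simp <;> omega
  have hsum : ∑ v ∈ f, x v * (if 1 ≤ v.2 then 1 else 0) ≤ max 0 (min 1 (∑ v ∈ f, x v * v.2)) := by
    rcases hrows with h | h
    · refine le_max_of_le_right (le_min ((Finset.sum_le_sum fun v _ => ?_).trans_eq hx.2.2) ?_)
      · exact mul_le_of_le_one_right (hx.1 v) (by split_ifs <;> norm_num)
      · refine Finset.sum_le_sum fun v hv => mul_le_mul_of_nonneg_left ?_ (hx.1 v)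
        have := h v hv
        split_ifs with h1 <;> exact_mod_cast ‹_›
    · refine le_max_of_le_left (Finset.sum_nonpos fun v hv => ?_)
      rw [if_neg (by linarith [h v hv]), mul_zero]
  rw [wsum_comp_reflection hx, wsum_of_mem_disk position hx]
  simp only [Prod.fst_sum, Prod.snd_sum, Prod.smul_fst, Prod.smul_snd, smul_eq_mul, position,
    reflection_apply]
  push_cast
  simp only [mul_sub, Finset.sum_sub_distrib]
  linarith

end Reflection

section Slant

variable {r : ℝ}

theorem pt_of_mem_triangle {p : ℝ × ℝ} (h1 : 0 ≤ p.1) (h2 : 0 ≤ p.2) (h : p.1 + p.2 ≤ 1) :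
    pt p ∈ disk {(0, 0), (1, 0), (0, 1)} ∧ pt p (1, 0) = p.1 ∧ pt p (0, 1) = p.2 := by
  have hf : Face turned {(0, 0), (1, 0), (0, 1)} := .lower (i := 0) (j := 0) rfl
  obtain ⟨hmem, hp⟩ := hf.hat_mem_disk (p := p) (sub_nonneg.2 h) h1 h2 (by ring)
    (by ext <;> simp [position])
  refine ⟨hmem, ?_⟩
  rw [wsum_triple position hf.card_eq hmem, Prod.ext_iff] at hp
  simpa [position, pt] using hp

theorem straightAt_of_eq_slant (hr : Irrational r) {α : ℝ} (hα : α ^ 2 * (1 - r + r ^ 2) = 1)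
    {γ : ℝ → ℤ × ℤ → ℝ} {t : ℝ} (ht : 0 < t * α)
    (h : ∀ t, 0 < t * α → γ t = pt (t * α, 1 / 2 - r * (t * α))) : model.StraightAt γ t := by
  refine straightAt_of_eventually_eq_pt (p := (t * α, 1 / 2 - r * (t * α))) (u := (α, -(r * α)))
    (by linear_combination hα) (mem_flatRegion_iff.2 (.inl ht)) (fun v hv => ?_) ?_
  · have h1 : t * α = v.1 := congrArg Prod.fst hv
    have h2 : 1 / 2 - r * (t * α) = v.2 := congrArg Prod.snd hv
    refine hr ⟨(1 / 2 - v.2) / v.1, ?_⟩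
    rw [h1] at h2 ht
    push_cast
    rw [← h2]
    field_simp
    ring
  · have hev : ∀ᶠ s in 𝓝 (0 : ℝ), 0 < (t + s) * α :=
      (Continuous.tendsto' (by fun_prop) 0 (t * α) (by simp)).eventually (lt_mem_nhds ht)
    filter_upwards [hev] with s hs
    rw [h _ hs]
    congr 1
    ext <;> simp <;> ring

/-- The curve that leaves `(0, 1 / 2)` to the right with slope `-r`, and to the left as the
reflection of the curve that leaves with slope `r - 1`, so that it does not turn. -/
noncomputable def slantPoint (r x : ℝ) : ℤ × ℤ → ℝ :=
  if 0 ≤ x then pt (x, 1 / 2 - r * x) else pt (-x, 1 / 2 - (1 - r) * -x) ∘ reflection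

theorem slantPoint_of_nonneg {x : ℝ} (hx : 0 ≤ x) : slantPoint r x = pt (x, 1 / 2 - r * x) :=
  if_pos hx

theorem slantPoint_of_neg {x : ℝ} (hx : x < 0) :
    slantPoint r x = pt (-x, 1 / 2 - (1 - r) * -x) ∘ reflection :=
  if_neg hx.not_ge

theorem slantPoint_mem_rhombus {x : ℝ} (h1 : |r * x| ≤ 1 / 2) (h2 : |(1 - r) * x| ≤ 1 / 2) :
    slantPoint r x ∈ disk {(-1, 0), (0, 0), (0, 1)} ∪ disk {(1, 0), (0, 0), (0, 1)} ∧
      slantPoint r x (0, 1) + slantPoint r x (1, 0) = 1 / 2 + (1 - r) * x ∧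
      slantPoint r x (-1, 0) - slantPoint r x (1, 0) = -x := by
  rw [abs_le] at h1 h2
  rcases le_or_gt 0 x with hx | hx
  · obtain ⟨hmem, h10, h01⟩ := pt_of_mem_triangle (p := (x, 1 / 2 - r * x)) hx
      (by dsimp only; linarith) (by dsimp only; linarith)
    rw [slantPoint_of_nonneg hx, h10, h01, hmem.2.1 (-1, 0) (by decide)]
    exact ⟨.inr (by rwa [Finset.insert_comm]), by ring, by ring⟩
  · obtain ⟨hmem, h10, h01⟩ := pt_of_mem_triangle (p := (-x, 1 / 2 - (1 - r) * -x))
      (neg_nonneg.2 hx.le) (by dsimp only; linarith) (by dsimp only; linarith)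
    have h' : reflection (0, 1) = (0, 1) ∧ reflection (1, 0) = (-1, 0) ∧
      reflection (-1, 0) = (1, 0) := by decide
    rw [slantPoint_of_neg hx, Function.comp_apply, Function.comp_apply, Function.comp_apply, h'.1,
      h'.2.1, h'.2.2, h10, h01, hmem.2.1 (-1, 0) (by decide)]
    refine ⟨.inl ?_, by ring, by ring⟩
    have hmap : ({(0, 0), (1, 0), (0, 1)} : Finset (ℤ × ℤ)).map reflection.symm.toEmbedding =
        {(-1, 0), (0, 0), (0, 1)} := by decide
    exact hmap ▸ comp_mem_disk reflection hmem

theorem straightAt_slantPoint_zero {α : ℝ} (hα : α ^ 2 * (1 - r + r ^ 2) = 1) :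
    model.StraightAt (fun t => slantPoint r (t * α)) 0 := by
  have hright : Face turned {(1, 0), (0, 0), (0, 1)} := by
    rw [Finset.insert_comm]
    exact .lower (i := 0) (j := 0) rfl
  have hev (q : ℝ) : ∀ᶠ s in 𝓝 (0 : ℝ), |q * (s * α)| ≤ 1 / 2 :=
    ((Continuous.tendsto' (by fun_prop) 0 0 (by simp)).eventually
      (gt_mem_nhds (by norm_num : (0 : ℝ) < 1 / 2))).mono fun _ h => le_of_lt h
  refine straightAt_iff.2 ⟨(-1, 0), (0, 0), (0, 1), (1, 0), by decide,
    .right (i := -1) (j := 0) rfl, hright, 1 / 2, 0, (1 - r) * α, -α, by linear_combination hα, ?_⟩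
  filter_upwards [hev r, hev (1 - r)] with s h1 h2
  obtain ⟨hmem, hc, ha⟩ := slantPoint_mem_rhombus h1 h2
  rw [zero_add]
  exact ⟨hmem, by rw [hc]; ring, by rw [ha]; ring⟩

theorem isGeodesic_slantPoint (hr : Irrational r) {α : ℝ} (hα : α ^ 2 * (1 - r + r ^ 2) = 1) :
    model.IsGeodesic fun t => slantPoint r (t * α) := by
  refine fun t => .inl ?_
  rcases lt_trichotomy (t * α) 0 with ht | ht | ht
  · have hinv : (reflection : ℤ × ℤ → ℤ × ℤ) ∘ reflection = id := reflection.symm_comp_self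
    have h := StraightAt.comp (γ := fun t => slantPoint r (t * α) ∘ reflection) (t := t)
      (straightAt_of_eq_slant (r := 1 - r) (α := -α) (by simpa using hr.ratCast_sub 1)
        (by linear_combination hα) (by linarith) fun t ht => by
          rw [slantPoint_of_neg (by linarith), Function.comp_assoc, hinv, Function.comp_id,
            ← mul_neg])
      reflection fun f hf => map_reflection_mem_faces hf
    simpa only [Function.comp_assoc, hinv, Function.comp_id] using h
  · have hα0 : α ≠ 0 := by rintro rfl; simp at hα
    rw [(mul_eq_zero.1 ht).resolve_right hα0]
    exact straightAt_slantPoint_zero hα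
  · exact straightAt_of_eq_slant hr hα ht fun t ht => slantPoint_of_nonneg ht.le

/-- The line of points of `slantPoint`. -/
def slantLine (r : ℝ) : Set (ℤ × ℤ → ℝ) := Set.range (slantPoint r)

theorem isLine_slantLine (hr : Irrational r) : model.IsLine (slantLine r) := by
  have hpos : 0 < 1 - r + r ^ 2 := by nlinarith [sq_nonneg (r - 1 / 2)]
  have hsqrt : √(1 - r + r ^ 2) ≠ 0 := (Real.sqrt_pos.2 hpos).ne'
  refine ⟨fun t => slantPoint r (t * (√(1 - r + r ^ 2))⁻¹), isGeodesic_slantPoint hr ?_, ?_⟩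
  · rw [inv_pow, Real.sq_sqrt hpos.le, inv_mul_cancel₀ hpos.ne']
  · exact ((mul_right_surjective₀ (inv_ne_zero hsqrt)).range_comp (slantPoint r)).symm

theorem pt_mem_slantLine {x : ℝ} (hx : 0 ≤ x) : pt (x, 1 / 2 - r * x) ∈ slantLine r :=
  ⟨x, slantPoint_of_nonneg hx⟩

theorem wsum_slantPoint_of_neg (hr : 0 < r) {x : ℝ} (hx : x < 0) :
    (wsum position (slantPoint r x)).1 ≤ 0 ∧ level (wsum position (slantPoint r x)) ≤ 1 := by
  have hmem := pt_mem_points (-x, 1 / 2 - (1 - r) * -x)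
  have h1 := wsum_comp_reflection_fst_le hmem
  have h2 := wsum_comp_reflection_snd hmem
  have hrx := mul_neg_of_pos_of_neg hr hx
  rw [level_apply, slantPoint_of_neg hx]
  rw [wsum_position_pt] at h1 h2
  dsimp only at h1 h2
  rcases max_cases 0 (min 1 (1 / 2 - (1 - r) * -x)) with h | h <;>
    rcases min_cases 1 (1 / 2 - (1 - r) * -x) with h' | h' <;> constructor <;> linarith

theorem disjoint_slantLine_levelLine (hr : 3 ≤ r) {c : ℝ} (hc : 1 < c) :
    Disjoint (slantLine r) (levelLine c) := by
  rw [Set.disjoint_left]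
  rintro _ ⟨x, rfl⟩ ⟨-, h⟩
  rcases le_or_gt 0 x with hx | hx
  · rw [slantPoint_of_nonneg hx, wsum_position_pt, level_apply] at h
    nlinarith
  · linarith [(wsum_slantPoint_of_neg (r := r) (by linarith) hx).2]

theorem not_disjoint_slantLine_levelLine (hr : r < 3) {c : ℝ} (hc : 1 / 2 ≤ c) :
    ¬ Disjoint (slantLine r) (levelLine c) := by
  refine Set.not_disjoint_iff.2 ⟨_, pt_mem_slantLine (x := (c - 1 / 2) / (3 - r))
    (div_nonneg (by linarith) (by linarith)), ?_⟩
  convert pt_mem_levelLine using 2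
  have h3 : 3 - r ≠ 0 := by linarith
  rw [level_apply]
  field_simp
  ring

theorem slantLine_injOn : Set.InjOn slantLine (Set.Ioi 0) := by
  intro r _ r' hr' h
  have hmem : pt (1, 1 / 2 - r * 1) ∈ slantLine r' := h ▸ pt_mem_slantLine zero_le_one
  obtain ⟨x, hx⟩ := hmem
  have hw := congrArg (wsum position) hx
  rw [wsum_position_pt] at hw
  rcases le_or_gt 0 x with h0 | h0
  · rw [slantPoint_of_nonneg h0, wsum_position_pt, Prod.mk.injEq] at hw
    obtain ⟨rfl, hw⟩ := hw
    linarith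
  · have := (wsum_slantPoint_of_neg hr' h0).1
    rw [hw] at this
    norm_num at this

end Slant

section Points

variable {c : ℝ}

theorem disjoint_levelLine {c' : ℝ} (h : c' ≠ c) : Disjoint (levelLine c') (levelLine c) :=
  Set.disjoint_left.2 fun _ hx hx' => h (hx.2.symm.trans hx'.2)

theorem pointOff_pt (hc : 1 < c) (hcz : ∀ n : ℤ, c ≠ n) {p : ℝ × ℝ} (hp : level p ≠ c) :
    model.PointOff (levelLine c) (pt p) :=
  ⟨isLine_levelLine hc hcz, pt_mem_points p, (disjoint_levelLine hp).notMem_of_mem_left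
    pt_mem_levelLine⟩

theorem isEuclideanPoint_pt (hc : 1 < c) (hcz : ∀ n : ℤ, c ≠ n) {p : ℝ × ℝ} (hp : c < level p)
    (hpz : ∀ n : ℤ, level p ≠ n) : model.IsEuclideanPoint (levelLine c) (pt p) :=
  ⟨pointOff_pt hc hcz hp.ne', levelLine (level p),
    ⟨isLine_levelLine (hc.trans hp) hpz, pt_mem_levelLine, disjoint_levelLine hp.ne'⟩,
    fun _ ⟨hm, hpm, hdisj⟩ => eq_levelLine_of_disjoint hm hc hp hpm pt_mem_levelLine hdisj⟩

theorem isEllipticPoint_single (hc : 1 < c) (hcz : ∀ n : ℤ, c ≠ n) :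
    model.IsEllipticPoint (levelLine c) (Pi.single (0, 0) 1) := by
  refine ⟨?_, parallels_single_eq_empty (zero_lt_one.trans hc)⟩
  have h0 : position (0, 0) = 0 := by simp [position]
  rw [← pt_position, h0]
  exact pointOff_pt hc hcz (by rw [map_zero]; linarith)

theorem infinite_irrational_Ioo {a b : ℝ} (h : a < b) : {r ∈ Set.Ioo a b | Irrational r}.Infinite :=
  fun hfin => h.not_ge <| Cardinal.Real.Ioo_countable_iff.1 <|
    (hfin.countable.union (Set.countable_range ((↑) : ℚ → ℝ))).mono fun r hr =>
      (em (Irrational r)).imp (fun h => ⟨hr, h⟩) not_not.1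

theorem isRegularlyHyperbolicPoint_pt (hc : 1 < c) (hcz : ∀ n : ℤ, c ≠ n) :
    model.IsRegularlyHyperbolicPoint (levelLine c) (pt (0, 1 / 2)) := by
  have hmem (r : ℝ) : pt (0, 1 / 2) ∈ slantLine r := by simpa using pt_mem_slantLine (r := r) le_rfl
  have hinj {a b : ℝ} (ha : 0 ≤ a) : Set.InjOn slantLine {r ∈ Set.Ioo a b | Irrational r} :=
    slantLine_injOn.mono fun r hr => ha.trans_lt hr.1.1
  have hpar : (model.parallels (levelLine c) (pt (0, 1 / 2))).Infinite := by
    have h34 : (3 : ℝ) < 4 := by norm_num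
    refine ((infinite_irrational_Ioo h34).image (hinj zero_le_three)).mono ?_
    rintro _ ⟨r, ⟨hr, hirr⟩, rfl⟩
    exact ⟨isLine_slantLine hirr, hmem r, disjoint_slantLine_levelLine hr.1.le hc⟩
  refine ⟨⟨pointOff_pt hc hcz ?_, hpar.nontrivial⟩, hpar, ?_⟩
  · rw [level_apply]
    dsimp only
    linarith
  · refine ((infinite_irrational_Ioo (zero_lt_three' ℝ)).image (hinj le_rfl)).mono ?_
    rintro _ ⟨r, ⟨hr, hirr⟩, rfl⟩
    exact ⟨isLine_slantLine hirr, hmem r, not_disjoint_slantLine_levelLine hr.2 (by linarith)⟩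

end Points

end SemiParadoxist

theorem mainTheorem1 :
    ∃ (V : Type) (_ : DecidableEq V) (M : SManifold V) (h e : V),
      M.IsModel h e ∧
      (∃ l : Set (V → ℝ), M.IsLine l ∧
        (∃ P : V → ℝ, M.IsEuclideanPoint l P) ∧
        (∃ Q : V → ℝ, M.IsEllipticPoint l Q) ∧
        (∃ R : V → ℝ, M.IsRegularlyHyperbolicPoint l R)) ∧
      M.IsSemiParadoxist := by
  open SemiParadoxist in
  have hint (n : ℤ) : (3 / 2 : ℝ) ≠ n := fun h => by
    have h' : (3 : ℤ) = 2 * n := by exact_mod_cast (by linarith : (3 : ℝ) = 2 * n)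
    omega
  have hint' (n : ℤ) : level (1 / 2, 1) ≠ n := fun h => by
    rw [level_apply] at h
    have h' : (5 : ℤ) = 2 * n := by exact_mod_cast (by linarith : (5 : ℝ) = 2 * n)
    omega
  have hP := isEuclideanPoint_pt (by norm_num) hint (by norm_num [level_apply]) hint'
  have hQ := isEllipticPoint_single (by norm_num) hint
  have hR := isRegularlyHyperbolicPoint_pt (by norm_num) hint
  exact ⟨ℤ × ℤ, inferInstance, model, (0, 1), (0, 0), isModel_model,
    ⟨levelLine (3 / 2), isLine_levelLine (by norm_num) hint, ⟨_, hP⟩, ⟨_, hQ⟩, ⟨_, hR⟩⟩,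
    ⟨_, _, hP⟩, ⟨_, _, hQ⟩, ⟨_, _, hR⟩⟩
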